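/- **Theorem (Consistency check is in polynomial time).** Let $G=(V,E)$ be a finite connected simple undirected graph with $n=|V|$. For distinct $x,y\in V$ let $I(x,y)$ be the set of vertices lying on induced paths between $x$ and $y$, and $I(x,x)=\emptyset$. A set $X\subseteq V$ is m-convex if $I(x,y)\subseteq X$ for all $x,y\in X$, $\mathrm{conv}(X)$ is the smallest m-convex set containing $X$, and $H\subseteq V$ is an m-halfspace (monophonic halfspace) if $H$ and $\overline H=V\setminus H$ are m-convex (so $\emptyset$ and $V$ are m-halfspaces). For an edge $uv$ write $uv\in\delta(H)$ if $u\in H$ and $v\notin H$. A labeled sample is a pair $(S,y)$ with $S\subseteq V$ and $y:S\to\{0,1\}$; $H$ is consistent with it if $y^{-1}(1)\subseteq H$ and $y^{-1}(0)\subseteq\overline H$. For an oriented edge $uv$ let $\triangle=N(u)\cap N(v)$; let $\square$ consist of $u$, $v$ and all vertices on $4$-cycles that have $uv$ as an edge; let $A^u$ (resp. $A^v$) be the set of $x\in\square\setminus\triangle$ with $d(x,u)<d(x,v)$ (resp. $d(x,u)>d(x,v)$); and let $T$ be $G$ with all edges inside $\square\cup\triangle$ deleted. Let $\varphi_{uv}$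 be the 2-SAT formula, with a variable "$x\in H$" for each $x\in V$, that is the conjunction of the following clauses: 1. $(x\in H\vee y\in H)\wedge(x\notin H\vee y\notin H)$ for all distinct non-adjacent $x,y\in\triangle$; 2. $(x\in H)$ for all $x\in\mathrm{conv}(A^u)$ and $(x\notin H)$ for all $x\in\mathrm{conv}(A^v)$; 3. $(x\in H\vee y\notin H)\wedge(x\notin H\vee y\in H)$ for all $x,y$ in the same connected component of $T$; 4. $(y\in H\vee z\notin H)$ for every induced path $(x,y,z)$ or $(x,w,y,z)$ with $x\in A^u$, $z\in\triangle$; and $(y\notin H\vee z\in H)$ for every such path with $x\in A^v$, $z\in\triangle$; 5. $(y\in H\vee z\notin H)$ for all $\{x,y\}\in E$ with $x\in\mathrm{conv}(A^u)$ and $z\in\triangle\setminus(N(x)\cup\{x\})$; and $(y\notin H\vee z\in H)$ for all $\{x,y\}\in E$ with $x\in\mathrm{conv}(A^v)$ and $z\in\triangle\setminus(N(x)\cup\{x\})$. Let $\varphi_{uv}(S,y)$ be $\varphi_{uv}$ together with the clauses $(x\in H)$ for $x\in y^{-1}(1)$ and $(x\notin H)$ for $x\in y^{-1}(0)$. The algorithm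 mh-check, given $G$ and $(S,y)$, returns a solution $H$ of $\varphi_{uv}(S,y)$ for some oriented edge $uv$ for which this formula is satisfiable; if there is no such $uv$, it returns $V$ or $\emptyset$ if one of them is consistent with $(S,y)$; otherwise it reports failure. Then: * for every oriented edge $uv$, the solutions of $\varphi_{uv}$ are exactly the m-halfspaces $H$ with $uv\in\delta(H)$, and $\varphi_{uv}$ can be computed from $G,u,v$ in time $\mathrm{poly}(n)$; * mh-check can be implemented to run in time $\mathrm{poly}(n)$; whenever it returns a set $H$, that set is an m-halfspace consistent with $(S,y)$, and whenever it reports failure, no m-halfspace is consistent with $(S,y)$. Time is the number of steps of a unit-cost random access machine with addition, subtraction and comparison, given the adjacency matrix of $G$ and the table of labels. -/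

import Mathlib

/-! ### Monophonic convexity -/

namespace Mono

section Graph

variable {V : Type*} (G : SimpleGraph V)

/-- The monophonic interval: the vertices on some induced (that is, chordless) path between
the distinct vertices `u` and `v`; it is empty for `u = v`. -/
def interval (u v : V) : Set V :=
  {z | u ≠ v ∧ ∃ p : G.Walk u v, p.IsPath ∧ p.IsChordless ∧ z ∈ p.support}

/-- `X` is monophonically convex. -/
def IsMConvex (X : Set V) : Prop :=
  ∀ u ∈ X, ∀ v ∈ X, interval G u v ⊆ X

/-- `H` is a monophonic halfspace: `H` and its complement are monophonically convex. -/
def IsMHalfspace (H : Set V) : Prop :=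
  IsMConvex G H ∧ IsMConvex G Hᶜ

/-- The monophonic convex hull: the smallest monophonically convex set containing `X`. -/
def mHull (X : Set V) : Set V :=
  ⋂₀ {C | IsMConvex G C ∧ X ⊆ C}

/-- `uv ∈ δ(H)`: the edge `uv` is in the cutset of `H`, with `u` on the side of `H`. -/
def InCut (H : Set V) (u v : V) : Prop :=
  G.Adj u v ∧ u ∈ H ∧ v ∉ H

/-- `H` is consistent with the labeled sample `(S, y)`: it contains all sample vertices with label `1` and none with label `0`. -/
def Consistent (S : Finset V) (y : S → Bool) (H : Set V) : Prop :=
  ∀ x : S, (y x = true → (x : V) ∈ H) ∧ (y x = false → (x : V) ∉ H)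

end Graph

/-! ### 2-SAT -/

/-- A literal: `(x, true)` reads `x ∈ H` and `(x, false)` reads `x ∉ H`. -/
abbrev Lit (V : Type*) := V × Bool

/-- A 2-CNF formula over the variables `V`: a set of clauses, each a disjunction of two literals.
The clause that consists of the single literal `l` is the pair `(l, l)`. -/
abbrev TwoCNF (V : Type*) := Set (Lit V × Lit V)

/-- The evaluation of a literal at `H ⊆ V`. -/
def Lit.Holds {V : Type*} (H : Set V) (l : Lit V) : Prop :=
  l.1 ∈ H ↔ l.2 = true

/-- `H` satisfies every clause of `φ`. -/
def TwoCNF.Sat {V : Type*} (H : Set V) (φ : TwoCNF V) : Prop :=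
  ∀ c ∈ φ, Lit.Holds H c.1 ∨ Lit.Holds H c.2

/-! ### The formula `φ_uv` -/

section Formula

variable {V : Type*} (G : SimpleGraph V)

/-- The common neighbours of `u` and `v`. -/
def tri (u v : V) : Set V :=
  {x | G.Adj u x ∧ G.Adj v x}

/-- The set `□_uv`: the vertices `u` and `v` and all vertices on 4-cycles `u, a, b, v`. -/
def square (u v : V) : Set V :=
  {x | x = u ∨ x = v ∨ ∃ a b, G.Adj u a ∧ G.Adj a b ∧ G.Adj b v ∧ a ≠ v ∧ b ≠ u ∧ (x = a ∨ x = b)}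

/-- The set `A^u` of `x ∈ □_uv \ (N(u) ∩ N(v))` that are nearer to `u` than to `v`. The set `A^v`
is `sideA G v u`. -/
def sideA (u v : V) : Set V :=
  {x | x ∈ square G u v ∧ x ∉ tri G u v ∧ G.dist x u < G.dist x v}

/-- The graph `T`: delete from `G` all edges inside `□_uv ∪ (N(u) ∩ N(v))`. -/
def cutGraph (u v : V) : SimpleGraph V :=
  G.deleteEdges {e | ∀ x ∈ e, x ∈ square G u v ∪ tri G u v}

/-- `(x, y, z)` is an induced path on three vertices. -/
def IsInducedPath3 (x y z : V) : Prop :=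
  G.Adj x y ∧ G.Adj y z ∧ x ≠ z ∧ ¬ G.Adj x z

/-- `(x, w, y, z)` is an induced path on four vertices. -/
def IsInducedPath4 (x w y z : V) : Prop :=
  G.Adj x w ∧ G.Adj w y ∧ G.Adj y z ∧ x ≠ y ∧ x ≠ z ∧ w ≠ z ∧
    ¬ G.Adj x y ∧ ¬ G.Adj x z ∧ ¬ G.Adj w z

/-- Distinct non-adjacent common neighbours of `u` and `v` lie on opposite sides. -/
def phiTri (u v : V) : TwoCNF V :=
  {c | ∃ x ∈ tri G u v, ∃ y ∈ tri G u v, x ≠ y ∧ ¬ G.Adj x y ∧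
    ∃ b : Bool, c = ((x, b), (y, b))}

/-- `conv(A^u) ⊆ H` and `conv(A^v) ∩ H = ∅`. -/
def phiConv (u v : V) : TwoCNF V :=
  {c | ∃ x ∈ mHull G (sideA G u v), c = ((x, true), (x, true))} ∪
  {c | ∃ x ∈ mHull G (sideA G v u), c = ((x, false), (x, false))}

/-- Every connected component of `T` lies on one side. -/
def phiT (u v : V) : TwoCNF V :=
  {c | ∃ x y, (cutGraph G u v).Reachable x y ∧ ∃ b : Bool, c = ((x, b), (y, !b))}

/-- The constraints `φ_{u,3}` (for `b = true`), and, with `u` and `v` exchanged and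
`b = false`, `φ_{v,3}`. -/
def phi3 (u v : V) (b : Bool) : TwoCNF V :=
  {c | ∃ x y z, x ∈ sideA G u v ∧ z ∈ tri G u v ∧ IsInducedPath3 G x y z ∧
    c = ((y, b), (z, !b))}

/-- The constraints `φ_{u,4}` (for `b = true`), and, with `u` and `v` exchanged and
`b = false`, `φ_{v,4}`. -/
def phi4 (u v : V) (b : Bool) : TwoCNF V :=
  {c | ∃ x w y z, x ∈ sideA G u v ∧ z ∈ tri G u v ∧ IsInducedPath4 G x w y z ∧
    c = ((y, b), (z, !b))}

/-- The constraints `φ_{A^u}` (for `b = true`), and, with `u` and `v` exchanged and `b = false`,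
`φ_{A^v}`. Here `z` is a common neighbour of `u` and `v` outside the closed neighbourhood
of `x`. -/
def phiA (u v : V) (b : Bool) : TwoCNF V :=
  {c | ∃ x y z, G.Adj x y ∧ x ∈ mHull G (sideA G u v) ∧ z ∈ tri G u v ∧ z ≠ x ∧ ¬ G.Adj x z ∧
    c = ((y, b), (z, !b))}

/-- The 2-CNF formula `φ_uv`, the conjunction of all constraints. -/
def phi (u v : V) : TwoCNF V :=
  phiTri G u v ∪ phiConv G u v ∪ phiT G u v ∪
    (phi3 G u v true ∪ phi3 G v u false) ∪
    (phi4 G u v true ∪ phi4 G v u false) ∪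
    (phiA G u v true ∪ phiA G v u false)

/-- The 2-CNF formula `φ_uv(S, y)`: the formula `φ_uv` with the labels of the sample as further
constraints. -/
def phiSample (S : Finset V) (y : S → Bool) (u v : V) : TwoCNF V :=
  phi G u v ∪ {c | ∃ x : S, c = (((x : V), y x), ((x : V), y x))}

/-- The possible results of the algorithm mh-check: a solution of `φ_uv(S, y)` for some oriented
edge `uv`; if no such formula is satisfiable, one of the trivial halfspaces `V` and `∅` if it is
consistent with the sample; and otherwise failure (`none`). -/
inductive MhCheckReturns (S : Finset V) (y : S → Bool) : Option (Set V) → Prop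
  | solution (u v : V) (H : Set V) (huv : G.Adj u v)
      (hH : TwoCNF.Sat H (phiSample G S y u v)) : MhCheckReturns S y (some H)
  | trivial (H : Set V)
      (hun : ∀ u v, G.Adj u v → ∀ K, ¬ TwoCNF.Sat K (phiSample G S y u v))
      (hH : H = Set.univ ∨ H = ∅) (hc : Consistent S y H) : MhCheckReturns S y (some H)
  | failure
      (hun : ∀ u v, G.Adj u v → ∀ K, ¬ TwoCNF.Sat K (phiSample G S y u v))
      (hV : ¬ Consistent S y Set.univ) (he : ¬ Consistent S y ∅) : MhCheckReturns S y none

/-- The answer `r` to the consistency problem is right: a consistent monophonic halfspace, or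
the report (`none`) that there is none, which has to be true. -/
def IsCorrectAnswer (S : Finset V) (y : S → Bool) : Option (Set V) → Prop
  | some H => IsMHalfspace G H ∧ Consistent S y H
  | none => ¬ ∃ H : Set V, IsMHalfspace G H ∧ Consistent S y H

end Formula

/-! ### A machine model with step count

Structured programs of a random access machine. The memory consists of registers and of
two-dimensional arrays, all with natural number entries. The arithmetic operations are addition,
truncated subtraction and comparison. There is no multiplication, so an entry computed in `t` steps
has `O(t)` bits more than the largest input, and unit cost is polynomially equivalent to Turing
machine time. -/

/-- The contents of the memory: register `x` holds `reg x`, and the entry `(i, j)` of the array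
`a` is `arr a i j`. -/
structure Store where
  reg : ℕ → ℕ
  arr : ℕ → ℕ → ℕ → ℕ

/-- Expressions of the programming language. -/
inductive Expr where
  | const (k : ℕ)
  | reg (x : ℕ)
  | read (a : ℕ) (i j : Expr)
  | add (e f : Expr)
  | sub (e f : Expr)
  | lt (e f : Expr)
  | eq (e f : Expr)

/-- The value of an expression; a comparison has value `1` if it is true and `0` otherwise. -/
def Expr.eval (s : Store) : Expr → ℕ
  | .const k => k
  | .reg x => s.reg x
  | .read a i j => s.arr a (i.eval s) (j.eval s)
  | .add e f => e.eval s + f.eval s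
  | .sub e f => e.eval s - f.eval s
  | .lt e f => if e.eval s < f.eval s then 1 else 0
  | .eq e f => if e.eval s = f.eval s then 1 else 0

/-- The number of steps that evaluating an expression takes: one for each operation in it. -/
def Expr.cost : Expr → ℕ
  | .const _ => 1
  | .reg _ => 1
  | .read _ i j => i.cost + j.cost + 1
  | .add e f => e.cost + f.cost + 1
  | .sub e f => e.cost + f.cost + 1
  | .lt e f => e.cost + f.cost + 1
  | .eq e f => e.cost + f.cost + 1

/-- Programs. -/
inductive Prog where
  | skip
  | assign (x : ℕ) (e : Expr)
  | write (a : ℕ) (i j e : Expr)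
  | seq (c d : Prog)
  | branch (b : Expr) (c d : Prog)
  | loop (b : Expr) (c : Prog)

/-- The memory after register `x` has been set to `k`. -/
def Store.setReg (s : Store) (x k : ℕ) : Store where
  reg := Function.update s.reg x k
  arr := s.arr

/-- The memory after entry `(i, j)` of the array `a` has been set to `k`. -/
def Store.setArr (s : Store) (a i j k : ℕ) : Store where
  reg := s.reg
  arr := Function.update s.arr a
    (Function.update (s.arr a) i (Function.update (s.arr a i) j k))

/-- `Exec c s t s'`: the program `c`, started with memory contents `s`, halts after exactly `t`
steps, with memory contents `s'`. Conditions are true if they are nonzero; `loop b c` repeats `c`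
while `b` is true. -/
inductive Exec : Prog → Store → ℕ → Store → Prop
  | skip (s : Store) : Exec .skip s 1 s
  | assign (x : ℕ) (e : Expr) (s : Store) :
      Exec (.assign x e) s (e.cost + 1) (s.setReg x (e.eval s))
  | write (a : ℕ) (i j e : Expr) (s : Store) :
      Exec (.write a i j e) s (i.cost + j.cost + e.cost + 1)
        (s.setArr a (i.eval s) (j.eval s) (e.eval s))
  | seq (c d : Prog) (s s' s'' : Store) (t t' : ℕ) (hc : Exec c s t s') (hd : Exec d s' t' s'') :
      Exec (.seq c d) s (t + t') s''
  | branch_true (b : Expr) (c d : Prog) (s s' : Store) (t : ℕ) (hb : b.eval s ≠ 0)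
      (hc : Exec c s t s') : Exec (.branch b c d) s (b.cost + 1 + t) s'
  | branch_false (b : Expr) (c d : Prog) (s s' : Store) (t : ℕ) (hb : b.eval s = 0)
      (hd : Exec d s t s') : Exec (.branch b c d) s (b.cost + 1 + t) s'
  | loop_true (b : Expr) (c : Prog) (s s' s'' : Store) (t t' : ℕ) (hb : b.eval s ≠ 0)
      (hc : Exec c s t s') (hl : Exec (.loop b c) s' t' s'') :
      Exec (.loop b c) s (b.cost + 1 + t + t') s''
  | loop_false (b : Expr) (c : Prog) (s : Store) (hb : b.eval s = 0) :
      Exec (.loop b c) s (b.cost + 1) s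

/-! ### Inputs and outputs -/

section InputOutput

open Classical in
/-- The `0`-`1` adjacency matrix of a graph on `n` vertices, with zeros outside its range. -/
noncomputable def adjTable {n : ℕ} (G : SimpleGraph (Fin n)) (i j : ℕ) : ℕ :=
  if ∃ a b : Fin n, (a : ℕ) = i ∧ (b : ℕ) = j ∧ G.Adj a b then 1 else 0

open Classical in
/-- The sample as a table of two rows: row `0` marks the vertices of `S`, and row `1` those with
label `1`; all else is zero. -/
noncomputable def sampleTable {n : ℕ} (S : Finset (Fin n)) (y : S → Bool) (i j : ℕ) : ℕ :=
  if ∃ x : S, ((x : Fin n) : ℕ) = j ∧ (i = 0 ∨ (i = 1 ∧ y x = true)) then 1 else 0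

/-- The input of the consistency check: `n` in register `0`, the adjacency matrix in array `0`, the
sample in array `1`, and zeros elsewhere. -/
noncomputable def checkInput {n : ℕ} (G : SimpleGraph (Fin n)) (S : Finset (Fin n))
    (y : S → Bool) : Store where
  reg := fun x => if x = 0 then n else 0
  arr := fun a => if a = 0 then adjTable G else if a = 1 then sampleTable S y else fun _ _ => 0

/-- The output of the consistency check: register `0` is zero for failure; otherwise row `0` of
array `2` marks the vertices of the set that is returned. -/
def checkOutput (n : ℕ) (s : Store) : Option (Set (Fin n)) :=
  if s.reg 0 = 0 then none else some {x | s.arr 2 0 x ≠ 0}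

/-- The input of the construction of `φ_uv`: `n`, `u`, `v` in the registers `0`, `1`, `2`, the
adjacency matrix in array `0`, and zeros elsewhere. -/
noncomputable def formulaInput {n : ℕ} (G : SimpleGraph (Fin n)) (u v : Fin n) : Store where
  reg := fun x => if x = 0 then n else if x = 1 then (u : ℕ) else if x = 2 then (v : ℕ) else 0
  arr := fun a => if a = 0 then adjTable G else fun _ _ => 0

/-- The number of a literal: `2 x + 1` for `x ∈ H` and `2 x` for `x ∉ H`. -/
def litCode {n : ℕ} (l : Lit (Fin n)) : ℕ :=
  2 * (l.1 : ℕ) + if l.2 = true then 1 else 0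

/-- The 2-CNF formula written in array `2`: the clause `(l, l')` is present if the entry at
the numbers of `l` and `l'` is nonzero. -/
def formulaOutput (n : ℕ) (s : Store) : TwoCNF (Fin n) :=
  {c | s.arr 2 (litCode c.1) (litCode c.2) ≠ 0}

end InputOutput

end Mono

/-! Halfspaces. If `H` is a halfspace cut by `uv`, any other cut edge `xy` with `x ∈ H` satisfies `y
= v` or `y ∼ v`: connect `x` to `u` by an induced path, which stays in `H`, add `y` and `v` at its
ends, and shorten to an induced path from `y` to `v`. That path lies in the complement, so it has no
interior vertex (`eq_or_adj_of_cut`). By symmetry `x = u` or `x ∼ u`. Hence every cut edge lies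
inside `□ ∪ △`, which gives the clauses of `T`; the other clauses come from exhibiting a short
induced path that would violate convexity of one side. Conversely, let `H` satisfy `φ_uv`. By the
clauses of `T`, an induced path that leaves `H` at `a` and returns at `c` has both `a` and `c` in
`A^u ∪ △`. Two ends in `A^u` are excluded by `conv(A^u) ⊆ H`, two in `△` by the triangle clauses,
and mixed ends by `phiA` (`isMConvex_of_constraints`). The complement is treated in the same way
with `u` and `v` exchanged. The clauses `phi3` and `phi4` therefore need checking only for
halfspaces.

Correctness of mh-check. A halfspace other than `∅` and the whole vertex set has a cut edge because
the graph is connected, so it is a solution of one of the formulas.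

Complexity. Instead of writing programs by hand, a class of predicates decidable in polynomial time
is shown to be closed under Boolean operations, quantifiers bounded by the size, and inflationary
fixed points with as many stages as the size (`Ctx.Def.ifp`). Every object of the algorithm is then
defined by a formula of this kind. Reachability is a fixed point. So is the convex hull, since a set
is convex once it contains the second vertices of induced paths between its members, and such
vertices are recognised by reachability outside a closed neighbourhood. Satisfiability of 2-CNF is
the absence of a literal equivalent to its complement in the implication graph. A solution is a
non-monotone fixed point: each round takes the least undecided literal that does not imply its
complement and makes true all that it implies. The size is `n + n`, the number of literals, so that
vertices and literals share one range. -/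

namespace Mono

/-! ### Induced paths -/

section InducedPaths

variable {V : Type*} {G : SimpleGraph V}

/-- The walk `p` is an induced path. -/
def IsIndPath {x y : V} (p : G.Walk x y) : Prop := p.IsPath ∧ p.IsChordless

theorem isIndPath_nil (x : V) : IsIndPath (SimpleGraph.Walk.nil : G.Walk x x) := by
  refine ⟨SimpleGraph.Walk.IsPath.nil, ?_⟩
  rw [SimpleGraph.Walk.isChordless_iff_forall_mem_edges]
  intro a b ha hb hab
  simp at ha hb
  subst ha hb
  exact absurd hab (G.loopless.irrefl _)

/-- A chord of the longer walk is either a chord of `q` or starts at `x`. This recursion replaces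
chordlessness in all inductions on walks below. -/
theorem isIndPath_cons {x w y : V} (h : G.Adj x w) (q : G.Walk w y) :
    IsIndPath (SimpleGraph.Walk.cons h q) ↔
      IsIndPath q ∧ x ∉ q.support ∧ ∀ z ∈ q.support, G.Adj x z → z = w := by
  unfold IsIndPath
  rw [SimpleGraph.Walk.cons_isPath_iff, SimpleGraph.Walk.isChordless_iff_forall_mem_edges,
    SimpleGraph.Walk.isChordless_iff_forall_mem_edges]
  constructor
  · rintro ⟨⟨hq, hx⟩, hc⟩
    refine ⟨⟨hq, ?_⟩, hx, ?_⟩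
    · intro a b ha hb hab
      have := hc (by simp [ha]) (by simp [hb]) hab
      simp only [SimpleGraph.Walk.edges_cons, List.mem_cons] at this
      rcases this with h' | h'
      · rw [Sym2.eq_iff] at h'
        rcases h' with ⟨rfl, rfl⟩ | ⟨rfl, rfl⟩
        · exact absurd ha hx
        · exact absurd hb hx
      · exact h'
    · intro z hz hxz
      have := hc (by simp) (by simp [hz]) hxz
      simp only [SimpleGraph.Walk.edges_cons, List.mem_cons] at this
      rcases this with h' | h'
      · rw [Sym2.eq_iff] at h'
        rcases h' with ⟨_, h'⟩ | ⟨rfl, rfl⟩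
        · exact h'
        · exact absurd h (G.loopless.irrefl _)
      · exact absurd (q.fst_mem_support_of_mem_edges h') hx
  · rintro ⟨⟨hq, hc⟩, hx, hn⟩
    refine ⟨⟨hq, hx⟩, ?_⟩
    intro a b ha hb hab
    simp only [SimpleGraph.Walk.support_cons, List.mem_cons] at ha hb
    simp only [SimpleGraph.Walk.edges_cons, List.mem_cons]
    rcases ha with rfl | ha <;> rcases hb with rfl | hb
    · exact absurd hab (G.loopless.irrefl _)
    · left; rw [hn b hb hab]
    · left; rw [hn a ha hab.symm, Sym2.eq_swap]
    · right; exact hc ha hb hab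

theorem IsIndPath.cons_of_support_subset {x w y c : V} {h : G.Adj x w} {q : G.Walk w y}
    (hq : IsIndPath (SimpleGraph.Walk.cons h q)) {r : G.Walk w c} (hr : IsIndPath r)
    (hs : r.support ⊆ q.support) : IsIndPath (SimpleGraph.Walk.cons h r) := by
  rw [isIndPath_cons] at hq ⊢
  exact ⟨hr, fun h => hq.2.1 (hs h), fun z hz => hq.2.2 z (hs hz)⟩

/-- The path enters `q` at the last vertex of `q` that equals or is adjacent to `x`; nothing after
that vertex touches `x`. The induction passes to the tail as long as the tail still meets the closed
neighbourhood of `x`. -/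
theorem exists_isIndPath_of_adj_support {w y : V} (q : G.Walk w y) (hq : IsIndPath q) (x : V)
    (hx : x ∈ q.support ∨ ∃ z ∈ q.support, G.Adj x z) :
    ∃ p : G.Walk x y, IsIndPath p ∧ ∀ z ∈ p.support, z = x ∨ z ∈ q.support := by
  induction q with
  | nil =>
    simp only [SimpleGraph.Walk.support_nil, List.mem_singleton, exists_eq_left] at hx
    rcases hx with rfl | hx
    · exact ⟨.nil, isIndPath_nil _, by simp⟩
    · refine ⟨.cons hx .nil, ?_, by simp⟩
      rw [isIndPath_cons]
      refine ⟨isIndPath_nil _, ?_, ?_⟩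
      · simpa using hx.ne
      · simp
  | @cons w w' y h q ih =>
    by_cases hx' : x ∈ q.support ∨ ∃ z ∈ q.support, G.Adj x z
    · obtain ⟨p, hp, hs⟩ := ih ((isIndPath_cons h q).1 hq).1 hx'
      refine ⟨p, hp, fun z hz => ?_⟩
      rcases hs z hz with h | h
      · exact .inl h
      · exact .inr (by simp [h])
    · push Not at hx'
      have hxw : x ≠ w := by
        rintro rfl
        exact hx'.2 w' q.start_mem_support h
      have hadj : G.Adj x w := by
        rcases hx with hx | ⟨z, hz, hxz⟩
        · simp only [SimpleGraph.Walk.support_cons, List.mem_cons] at hx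
          rcases hx with hx | hx
          · exact absurd hx hxw
          · exact absurd hx hx'.1
        · simp only [SimpleGraph.Walk.support_cons, List.mem_cons] at hz
          rcases hz with rfl | hz
          · exact hxz
          · exact absurd hxz (hx'.2 z hz)
      refine ⟨.cons hadj (.cons h q), ?_, by simp⟩
      rw [isIndPath_cons]
      refine ⟨hq, ?_, ?_⟩
      · simpa using ⟨hxw, hx'.1⟩
      · intro z hz hxz
        simp only [SimpleGraph.Walk.support_cons, List.mem_cons] at hz
        rcases hz with rfl | hz
        · rfl
        · exact absurd hxz (hx'.2 z hz)

theorem exists_isIndPath_support_subset {x y : V} (p : G.Walk x y) :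
    ∃ q : G.Walk x y, IsIndPath q ∧ q.support ⊆ p.support := by
  induction p with
  | nil => exact ⟨.nil, isIndPath_nil _, by simp⟩
  | @cons x w y h p ih =>
    obtain ⟨q, hq, hs⟩ := ih
    obtain ⟨r, hr, hs'⟩ :=
      exists_isIndPath_of_adj_support q hq x (.inr ⟨w, q.start_mem_support, h⟩)
    refine ⟨r, hr, fun z hz => ?_⟩
    rcases hs' z hz with h | h
    · simp [h]
    · simp [hs h]

theorem mem_interval {x y z : V} :
    z ∈ interval G x y ↔ x ≠ y ∧ ∃ p : G.Walk x y, IsIndPath p ∧ z ∈ p.support := by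
  simp [interval, IsIndPath, and_assoc]

theorem IsMConvex.support_subset {X : Set V} (hX : IsMConvex G X) {x y : V} (hx : x ∈ X)
    (hy : y ∈ X) {p : G.Walk x y} (hp : IsIndPath p) : ∀ z ∈ p.support, z ∈ X := by
  intro z hz
  by_cases hxy : x = y
  -- `interval G x x` is empty by definition, but an induced path with equal ends is the trivial
  -- one.
  · subst hxy
    obtain rfl := ((SimpleGraph.Walk.isPath_iff_nil (p := p)).1 hp.1).eq_nil
    simp at hz
    exact hz ▸ hx
  · exact hX x hx y hy (mem_interval.2 ⟨hxy, p, hp, hz⟩)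

theorem isMConvex_mHull (X : Set V) : IsMConvex G (mHull G X) := by
  intro x hx y hy z hz C hC
  exact hC.1 x (hx C hC) y (hy C hC) hz

theorem subset_mHull (X : Set V) : X ⊆ mHull G X := fun _ hx _ hC => hC.2 hx

theorem mHull_subset {X C : Set V} (hC : IsMConvex G C) (h : X ⊆ C) : mHull G X ⊆ C :=
  Set.sInter_subset_of_mem ⟨hC, h⟩

/-- An induced path that leaves a set and ends in it has a first vertex of the set. -/
theorem exists_isIndPath_first_mem {X : Set V} {p b : V} (q : G.Walk p b) (hq : IsIndPath q)
    (hp : p ∉ X) (hb : b ∈ X) :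
    ∃ c ∈ X, ∃ d ∉ X, G.Adj c d ∧ ∃ r : G.Walk p c, IsIndPath r ∧ r.support ⊆ q.support := by
  induction q with
  | nil => exact absurd hb hp
  | @cons p w b h q ih =>
    by_cases hw : w ∈ X
    · refine ⟨w, hw, p, hp, h.symm, .cons h .nil, ?_, by simp⟩
      exact hq.cons_of_support_subset (isIndPath_nil _) (by simp)
    · obtain ⟨c, hc, d, hd, hcd, r, hr, hs⟩ := ih ((isIndPath_cons h q).1 hq).1 hw hb
      refine ⟨c, hc, d, hd, hcd, .cons h r, hq.cons_of_support_subset hr hs, ?_⟩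
      simp only [SimpleGraph.Walk.support_cons]
      exact List.cons_subset_cons _ hs

/-- A set is convex if no induced path leaves it from `a` to `p` and returns to it at `c`. -/
theorem isMConvex_of_forall_exit {X : Set V}
    (h : ∀ a ∈ X, ∀ p ∉ X, ∀ c ∈ X, ∀ d ∉ X, G.Adj c d → ∀ (hap : G.Adj a p) (r : G.Walk p c),
      ¬ IsIndPath (SimpleGraph.Walk.cons hap r)) : IsMConvex G X := by
  intro a ha b hb z hz
  obtain ⟨-, p, hp, hzp⟩ := mem_interval.1 hz
  clear hz
  induction p with
  | nil => simp at hzp; exact hzp ▸ ha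
  | @cons a w b hadj q ih =>
    have hq := ((isIndPath_cons hadj q).1 hp).1
    by_cases hw : w ∈ X
    · simp only [SimpleGraph.Walk.support_cons, List.mem_cons] at hzp
      rcases hzp with rfl | hz
      · exact ha
      · exact ih hw hb hq hz
    -- Cut the path at its first return to `X`; an initial piece of an induced path is induced.
    · obtain ⟨c, hc, d, hd, hcd, r, hr, hs⟩ := exists_isIndPath_first_mem q hq hw hb
      exact absurd (hp.cons_of_support_subset hr hs) (h a ha w hw c hc d hd hcd hadj r)

/-- The second vertices of the induced paths between two nonadjacent vertices. -/
theorem mem_interval_of_walk {x y w z : V} (hxy : x ≠ y) (hxw : G.Adj x w)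
    (hwz : G.Adj w z) (p : G.Walk z y) (hp : ∀ a ∈ p.support, a ≠ x ∧ ¬ G.Adj x a) :
    w ∈ interval G x y := by
  -- Shorten `p` to an induced path and attach `w` to it at the last contact. The result consists of
  -- `w` and vertices of `p`, so `w` is the only neighbour of `x` on it.
  obtain ⟨q, hq, hs⟩ := exists_isIndPath_support_subset p
  obtain ⟨r, hr, hs'⟩ :=
    exists_isIndPath_of_adj_support q hq w (.inr ⟨z, q.start_mem_support, hwz⟩)
  refine mem_interval.2 ⟨hxy, .cons hxw r, (isIndPath_cons _ _).2 ⟨hr, ?_, ?_⟩, by simp⟩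
  · intro hx
    rcases hs' x hx with h | h
    · exact hxw.ne h
    · exact (hp x (hs h)).1 rfl
  · intro a ha hxa
    rcases hs' a ha with h | h
    · exact h
    · exact absurd hxa (hp a (hs h)).2

/-- Closure under second vertices of induced paths implies convexity. -/
theorem isMConvex_of_forall_walk {X : Set V}
    (h : ∀ x ∈ X, ∀ y ∈ X, ∀ w z, x ≠ y → ¬ G.Adj x y → G.Adj x w → G.Adj w z →
      (∃ p : G.Walk z y, ∀ a ∈ p.support, a ≠ x ∧ ¬ G.Adj x a) → w ∈ X) : IsMConvex G X := by
  refine isMConvex_of_forall_exit fun a ha p hp c hc d hd hcd hap r hr => ?_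
  have hr' := (isIndPath_cons _ _).1 hr
  have hpc : p ≠ c := fun h => hp (h ▸ hc)
  have hac : a ≠ c := fun h => hr'.2.1 (h ▸ r.end_mem_support)
  have hnac : ¬ G.Adj a c := fun h => hpc (hr'.2.2 c r.end_mem_support h).symm
  -- Beyond `p` the path avoids the closed neighbourhood of `a`, since `p` is the only neighbour of
  -- `a` on it and does not occur again.
  cases r with
  | nil => exact hpc rfl
  | @cons _ z _ hpz q =>
    refine hp (h a ha c hc p z hac hnac hap hpz ⟨q, fun b hb => ⟨?_, ?_⟩⟩)
    · rintro rfl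
      exact hr'.2.1 (by simp [hb])
    · intro hab
      have hb' := hr'.2.2 b (by simp [hb]) hab
      have := ((isIndPath_cons _ _).1 hr'.1).2.1
      exact this (hb' ▸ hb)

end InducedPaths

/-! ### The solutions of `φ_uv` -/

section Solutions

variable {V : Type*} {G : SimpleGraph V} {u v : V}

theorem tri_comm (u v : V) : tri G u v = tri G v u := by
  ext x; simp [tri, and_comm]

/-- A description of `A^u` without distances. -/
theorem mem_sideA_iff (hG : G.Connected) (huv : G.Adj u v) (x : V) :
    x ∈ sideA G u v ↔
      x = u ∨ (G.Adj u x ∧ ¬ G.Adj v x ∧ x ≠ v ∧ ∃ b, G.Adj x b ∧ G.Adj b v ∧ b ≠ u) := by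
  -- Distance one against distance at least two. Connectedness matters: `dist` is zero between
  -- vertices in different components.
  have far : ∀ {p q r : V}, G.Adj p q → ¬ G.Adj p r → p ≠ r → G.dist p q < G.dist p r := by
    intro p q r h1 h2 h3
    rw [SimpleGraph.dist_eq_one_iff_adj.2 h1]
    have h0 := hG.pos_dist_of_ne h3
    have : G.dist p r ≠ 1 := fun h => h2 (SimpleGraph.dist_eq_one_iff_adj.1 h)
    omega
  constructor
  · rintro ⟨h | rfl | ⟨a, b, h1, h2, h3, h4, h5, h6⟩, ht, hd⟩
    · exact .inl h
    · simp at hd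
    · rcases h6 with rfl | rfl
      · exact .inr ⟨h1, fun h => ht ⟨h1, h⟩, h4, b, h2, h3, h5⟩
      · exfalso
        have := far (r := u) h3 (fun h => ht ⟨h.symm, h3.symm⟩) h5
        omega
  · rintro (rfl | ⟨h1, h2, h3, b, h4, h5, h6⟩)
    · refine ⟨.inl rfl, fun h => G.loopless.irrefl _ h.1, ?_⟩
      simpa using hG.pos_dist_of_ne huv.ne
    · exact ⟨.inr (.inr ⟨x, b, h1, h4, h5, h3, h6, .inl rfl⟩), fun h => h2 h.2,
        far h1.symm (fun h => h2 h.symm) h3⟩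

theorem mem_sideA_or (hG : G.Connected) (huv : G.Adj u v) {x : V}
    (hx : x ∈ square G u v ∪ tri G u v) :
    x ∈ sideA G u v ∨ x ∈ sideA G v u ∨ x ∈ tri G u v := by
  by_cases ht : x ∈ tri G u v
  · exact .inr (.inr ht)
  rcases hx with (h | h | ⟨a, b, h1, h2, h3, h4, h5, h6⟩) | h
  · exact .inl ((mem_sideA_iff hG huv x).2 (.inl h))
  · exact .inr (.inl ((mem_sideA_iff hG huv.symm x).2 (.inl h)))
  · rcases h6 with rfl | rfl
    · exact .inl ((mem_sideA_iff hG huv x).2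
        (.inr ⟨h1, fun h => ht ⟨h1, h⟩, h4, b, h2, h3, h5⟩))
    · exact .inr (.inl ((mem_sideA_iff hG huv.symm x).2
        (.inr ⟨h3.symm, fun h => ht ⟨h, h3.symm⟩, h5, a, h2.symm, h1.symm, h4⟩)))
  · exact absurd h ht

/-- Stated for an abstract side, to be used for `H` with `A^u` and for its complement with `A^v`;
`D` is the common neighbourhood. The ends `a` and `c` of an excursion outside `K` lie in `A ∪ D`. If
both are in `A`, the excursion lies in the hull; if both are in `D`, `hD` applies; if only one is in
`A`, `hAD` applies to the edge by which the path leaves it or, at the returning end, to the edge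
`cd`. -/
theorem isMConvex_of_constraints {K A D : Set V}
    (hcut : ∀ a ∈ K, ∀ p ∉ K, G.Adj a p → a ∈ A ∨ a ∈ D) (hA : mHull G A ⊆ K)
    (hD : ∀ x ∈ D, ∀ y ∈ D, x ≠ y → ¬ G.Adj x y → ¬ (x ∈ K ∧ y ∈ K))
    (hAD : ∀ x y z, G.Adj x y → x ∈ mHull G A → z ∈ D → z ≠ x → ¬ G.Adj x z → y ∈ K ∨ z ∉ K) :
    IsMConvex G K := by
  refine isMConvex_of_forall_exit fun a ha p hp c hc d hd hcd hap r hr => ?_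
  have hr' := (isIndPath_cons _ _).1 hr
  have hpc : c ≠ p := fun h => hp (h ▸ hc)
  have hac : a ≠ c := fun h => hr'.2.1 (h ▸ r.end_mem_support)
  have hnac : ¬ G.Adj a c := fun h => hpc (hr'.2.2 c r.end_mem_support h)
  rcases hcut a ha p hp hap with haA | haD <;> rcases hcut c hc d hd hcd with hcA | hcD
  · exact hp (hA ((isMConvex_mHull A).support_subset (subset_mHull A haA) (subset_mHull A hcA) hr p
      (by simp)))
  · rcases hAD a p c hap (subset_mHull A haA) hcD hac.symm hnac with h | h
    · exact hp h
    · exact h hc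
  · rcases hAD c d a hcd (subset_mHull A hcA) haD hac (fun h => hnac h.symm) with h | h
    · exact hd h
    · exact h ha
  · exact hD a haD c hcD hac hnac ⟨ha, hc⟩

/-- Otherwise the edge survives in `T`, and the clause `a ∉ H ∨ p ∈ H` is violated. -/
theorem mem_square_of_cut {H : Set V} {a p : V} (hap : G.Adj a p)
    (hT : ∀ c ∈ phiT G u v, Lit.Holds H c.1 ∨ Lit.Holds H c.2) (ha : a ∈ H) (hp : p ∉ H) :
    a ∈ square G u v ∪ tri G u v ∧ p ∈ square G u v ∪ tri G u v := by
  by_contra hcon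
  have : (cutGraph G u v).Adj a p := by
    rw [cutGraph, SimpleGraph.deleteEdges_adj]
    exact ⟨hap, fun h => hcon ⟨h a (by simp), h p (by simp)⟩⟩
  have := hT ((a, false), (p, true)) ⟨a, p, this.reachable, false, rfl⟩
  simp [Lit.Holds, ha, hp] at this

theorem isMHalfspace_of_sat (hG : G.Connected) (huv : G.Adj u v) {H : Set V}
    (h : TwoCNF.Sat H (phi G u v)) : IsMHalfspace G H ∧ InCut G H u v := by
  have hTri : ∀ x ∈ tri G u v, ∀ y ∈ tri G u v, x ≠ y → ¬ G.Adj x y → ∀ b : Bool,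
      Lit.Holds H (x, b) ∨ Lit.Holds H (y, b) := fun x hx y hy hxy hn b =>
    h ((x, b), (y, b)) (.inl (.inl (.inl (.inl (.inl ⟨x, hx, y, hy, hxy, hn, b, rfl⟩)))))
  have hA : mHull G (sideA G u v) ⊆ H := fun x hx => by
    have := h ((x, true), (x, true)) (by simp only [phi, phiConv, Set.mem_union]; simp; tauto)
    simpa [Lit.Holds] using this
  have hA' : mHull G (sideA G v u) ⊆ Hᶜ := fun x hx => by
    have := h ((x, false), (x, false)) (by simp only [phi, phiConv, Set.mem_union]; simp; tauto)
    simpa [Lit.Holds] using this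
  have hT : ∀ c ∈ phiT G u v, Lit.Holds H c.1 ∨ Lit.Holds H c.2 := fun c hc =>
    h c (by simp only [phi, Set.mem_union]; tauto)
  have hAD : ∀ x y z, G.Adj x y → x ∈ mHull G (sideA G u v) → z ∈ tri G u v → z ≠ x →
      ¬ G.Adj x z → y ∈ H ∨ z ∉ H := fun x y z h1 h2 h3 h4 h5 => by
    have := h ((y, true), (z, false)) (Or.inr (Or.inl ⟨x, y, z, h1, h2, h3, h4, h5, rfl⟩))
    simpa [Lit.Holds] using this
  have hAD' : ∀ x y z, G.Adj x y → x ∈ mHull G (sideA G v u) → z ∈ tri G v u → z ≠ x →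
      ¬ G.Adj x z → y ∈ Hᶜ ∨ z ∉ Hᶜ := fun x y z h1 h2 h3 h4 h5 => by
    have := h ((y, false), (z, true)) (Or.inr (Or.inr ⟨x, y, z, h1, h2, h3, h4, h5, rfl⟩))
    simpa [Lit.Holds] using this
  have huH : u ∈ H := hA (subset_mHull _ ((mem_sideA_iff hG huv u).2 (.inl rfl)))
  have hvH : v ∉ H := hA' (subset_mHull _ ((mem_sideA_iff hG huv.symm v).2 (.inl rfl)))
  refine ⟨⟨isMConvex_of_constraints ?_ hA ?_ hAD, isMConvex_of_constraints ?_ hA' ?_ hAD'⟩,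
    huv, huH, hvH⟩
  · intro a ha p hp hap
    rcases mem_sideA_or hG huv (mem_square_of_cut hap hT ha hp).1 with h | h | h
    · exact .inl h
    · exact absurd ha (hA' (subset_mHull _ h))
    · exact .inr h
  · rintro x hx y hy hxy hn ⟨h1, h2⟩
    have := hTri x hx y hy hxy hn false
    simp [Lit.Holds, h1, h2] at this
  · intro a ha p hp hap
    rcases mem_sideA_or hG huv (mem_square_of_cut hap.symm hT (not_not.1 hp) ha).2 with h | h | h
    · exact absurd (hA (subset_mHull _ h)) ha
    · exact .inl h
    · exact .inr (tri_comm u v ▸ h)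
  · rintro x hx y hy hxy hn ⟨h1, h2⟩
    rw [tri_comm] at hx hy
    have := hTri x hx y hy hxy hn true
    simp only [Lit.Holds, iff_true] at this
    exact this.elim h1 h2

/-- The ends of two cut edges on the side of the complement of a convex set are equal or
adjacent. -/
theorem eq_or_adj_of_cut (hG : G.Connected) {H : Set V} (hH : IsMConvex G H)
    (hH' : IsMConvex G Hᶜ) {x y : V} (hxy : G.Adj x y) (huv : G.Adj u v) (hx : x ∈ H) (hy : y ∉ H)
    (hu : u ∈ H) (hv : v ∉ H) : y = v ∨ G.Adj y v := by
  by_contra hcon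
  push Not at hcon
  obtain ⟨p⟩ := hG.preconnected x u
  obtain ⟨q, hq, -⟩ := exists_isIndPath_support_subset p
  have hqH := hH.support_subset hx hu hq
  -- The walk `y, x, …, u, v` has all vertices other than `y` and `v` in `H`, while an induced path
  -- between `y` and `v` stays outside `H`. So the second vertex of `r` can only be `v`.
  obtain ⟨r, hr, hrs⟩ :=
    exists_isIndPath_support_subset (SimpleGraph.Walk.cons hxy.symm (q.concat huv))
  have hrH := hH'.support_subset hy hv hr
  cases r with
  | nil => exact hcon.1 rfl
  | @cons _ w _ hyw r =>
    have hw : w ∈ (SimpleGraph.Walk.cons hyw r).support := by simp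
    have hw' := hrs hw
    simp only [SimpleGraph.Walk.support_cons, SimpleGraph.Walk.support_concat,  List.mem_cons, List.mem_append, List.not_mem_nil, or_false] at hw'
    rcases hw' with rfl | h | rfl
    · exact G.loopless.irrefl _ hyw
    · exact hrH w hw (hqH w h)
    · exact hcon.2 hyw

theorem IsMConvex.mem_of_path3 {H : Set V} (hH : IsMConvex G H) {x y z : V}
    (h : IsInducedPath3 G x y z) (hx : x ∈ H) (hz : z ∈ H) : y ∈ H := by
  obtain ⟨h1, h2, h3, h4⟩ := h
  refine hH.support_subset hx hz (p := .cons h1 (.cons h2 .nil)) ?_ y (by simp)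
  simp only [isIndPath_cons, SimpleGraph.Walk.support_cons, SimpleGraph.Walk.support_nil]
  refine ⟨⟨isIndPath_nil _, ?_, ?_⟩, ?_, ?_⟩
  · simpa using h2.ne
  · simp
  · simpa using ⟨h1.ne, h3⟩
  · simp [h4]

theorem IsMConvex.mem_of_path4 {H : Set V} (hH : IsMConvex G H) {x w y z : V}
    (h : IsInducedPath4 G x w y z) (hx : x ∈ H) (hz : z ∈ H) : w ∈ H ∧ y ∈ H := by
  obtain ⟨h1, h2, h3, h4, h5, h6, h7, h8, h9⟩ := h
  have hp : IsIndPath (.cons h1 (.cons h2 (.cons h3 .nil)) : G.Walk x z) := by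
    simp only [isIndPath_cons, SimpleGraph.Walk.support_cons, SimpleGraph.Walk.support_nil]
    refine ⟨⟨⟨isIndPath_nil _, ?_, ?_⟩, ?_, ?_⟩, ?_, ?_⟩
    · simpa using h3.ne
    · simp
    · simpa using ⟨h2.ne, h6⟩
    · simp [h9]
    · simpa using ⟨h1.ne, h4, h5⟩
    · simp [h7, h8]
  exact ⟨hH.support_subset hx hz hp w (by simp), hH.support_subset hx hz hp y (by simp)⟩

/-- For `x ≠ u` in `A^u` the path `x, u, v` is induced, so `x` outside `H` would force `u` outside
`H`. -/
theorem sideA_subset_of_halfspace (hG : G.Connected) {H : Set V} (hH' : IsMConvex G Hᶜ)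
    (huv : G.Adj u v) (hu : u ∈ H) (hv : v ∉ H) : sideA G u v ⊆ H := by
  intro x hx
  rcases (mem_sideA_iff hG huv x).1 hx with rfl | ⟨h1, h2, h3, -⟩
  · exact hu
  · by_contra hxH
    exact hH'.mem_of_path3 ⟨h1.symm, huv, h3, fun h => h2 h.symm⟩ hxH hv hu

/-- Suppose `y ∉ H`. The vertex `v` is not adjacent to `x`, since the induced path `x, v, z` would
put `v` in `H`. As `xy` is a cut edge, `y ∼ v`. Then `x, y, z` or `x, y, v, z` is an induced path
between members of `H` through `y`. -/
theorem mem_of_adj_of_mem_tri (hG : G.Connected) {H : Set V} (hH : IsMConvex G H)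
    (hH' : IsMConvex G Hᶜ) (huv : G.Adj u v) (hu : u ∈ H) (hv : v ∉ H) {x y z : V}
    (hxy : G.Adj x y) (hx : x ∈ H) (hz : z ∈ tri G u v) (hzx : z ≠ x)
    (hn : ¬ G.Adj x z) (hzH : z ∈ H) : y ∈ H := by
  by_contra hy
  have hxv : ¬ G.Adj x v := fun h => hv (hH.mem_of_path3 ⟨h, hz.2, hzx.symm, hn⟩ hx hzH)
  rcases eq_or_adj_of_cut hG hH hH' hxy huv hx hy hu hv with rfl | hyv
  · exact hxv hxy
  · by_cases hyz : G.Adj y z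
    · exact hy (hH.mem_of_path3 ⟨hxy, hyz, hzx.symm, hn⟩ hx hzH)
    · have hyz' : y ≠ z := fun h => hy (h ▸ hzH)
      have hxv' : x ≠ v := fun h => hv (h ▸ hx)
      exact hy (hH.mem_of_path4 ⟨hxy, hyv, hz.2, hxv', hzx.symm, hyz', hxv, hn, hyz⟩ hx hzH).1

/-- Applied to both sides, `eq_or_adj_of_cut` puts `x` in the closed neighbourhood of `u` and `y` in
that of `v`. If neither equality holds, `u, x, y, v` is a 4-cycle; otherwise the edge `xy` has an
end at `u` or `v`, and its other end is `u`, `v` or a common neighbour. -/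
theorem mem_square_of_halfspace (hG : G.Connected) {H : Set V} (hH : IsMConvex G H)
    (hH' : IsMConvex G Hᶜ) (huv : G.Adj u v) (hu : u ∈ H) (hv : v ∉ H) {x y : V}
    (hxy : G.Adj x y) (hx : x ∈ H) (hy : y ∉ H) :
    x ∈ square G u v ∪ tri G u v ∧ y ∈ square G u v ∪ tri G u v := by
  have h1 := eq_or_adj_of_cut hG hH hH' hxy huv hx hy hu hv
  have h2 : x = u ∨ G.Adj x u :=
    eq_or_adj_of_cut hG hH' (by rwa [compl_compl]) hxy.symm huv.symm hy (by simpa using hx) hv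
      (by simpa using hu)
  rcases h1 with rfl | h1 <;> rcases h2 with rfl | h2
  · exact ⟨.inl (.inl rfl), .inl (.inr (.inl rfl))⟩
  · exact ⟨.inr ⟨h2.symm, hxy.symm⟩, .inl (.inr (.inl rfl))⟩
  · exact ⟨.inl (.inl rfl), .inr ⟨hxy, h1.symm⟩⟩
  · have hxv : x ≠ v := fun h => hv (h ▸ hx)
    have hyu : y ≠ u := fun h => hy (h ▸ hu)
    exact ⟨.inl (.inr (.inr ⟨x, y, h2.symm, hxy, h1, hxv, hyu, .inl rfl⟩)),
      .inl (.inr (.inr ⟨x, y, h2.symm, hxy, h1, hxv, hyu, .inr rfl⟩))⟩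

theorem mem_iff_of_reachable_cutGraph (hG : G.Connected) {H : Set V} (hH : IsMConvex G H)
    (hH' : IsMConvex G Hᶜ) (huv : G.Adj u v) (hu : u ∈ H) (hv : v ∉ H) {x y : V}
    (h : (cutGraph G u v).Reachable x y) : x ∈ H ↔ y ∈ H := by
  obtain ⟨p⟩ := h
  induction p with
  | nil => rfl
  | @cons x w y hxw p ih =>
    rw [← ih]
    rw [cutGraph, SimpleGraph.deleteEdges_adj] at hxw
    obtain ⟨h1, h2⟩ := hxw
    by_contra hcon
    apply h2
    have key : x ∈ square G u v ∪ tri G u v ∧ w ∈ square G u v ∪ tri G u v := by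
      by_cases hx : x ∈ H
      · exact mem_square_of_halfspace hG hH hH' huv hu hv h1 hx (by tauto)
      · exact (mem_square_of_halfspace hG hH hH' huv hu hv h1.symm (by tauto) hx).symm
    intro z hz
    rcases Sym2.mem_iff.1 hz with rfl | rfl
    exacts [key.1, key.2]

theorem sat_of_isMHalfspace (hG : G.Connected) {H : Set V} (hH : IsMHalfspace G H)
    (hc : InCut G H u v) : TwoCNF.Sat H (phi G u v) := by
  obtain ⟨h1, h2⟩ := hH
  obtain ⟨huv, hu, hv⟩ := hc
  have h1' : IsMConvex G Hᶜᶜ := by rwa [compl_compl]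
  have hu' : u ∉ Hᶜ := by simpa using hu
  have hA := sideA_subset_of_halfspace hG h2 huv hu hv
  have hA' := sideA_subset_of_halfspace hG h1' huv.symm hv hu'
  rintro c (((((hc | hc) | hc) | hc) | hc) | hc)
  -- Two such vertices in `H` would pull in `v`, and two outside `H` would pull out `u`.
  · obtain ⟨x, hx, y, hy, hxy, hn, b, rfl⟩ := hc
    by_contra hcon
    cases b
    · simp only [Lit.Holds, Bool.false_eq_true, iff_false, not_or, not_not] at hcon
      exact hv (h1.mem_of_path3 ⟨hx.2.symm, hy.2, hxy, hn⟩ hcon.1 hcon.2)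
    · simp only [Lit.Holds, iff_true, not_or] at hcon
      exact h2.mem_of_path3 ⟨hx.1.symm, hy.1, hxy, hn⟩ hcon.1 hcon.2 hu
  · rcases hc with ⟨x, hx, rfl⟩ | ⟨x, hx, rfl⟩
    · left; simpa [Lit.Holds] using mHull_subset h1 hA hx
    · left; simpa [Lit.Holds] using mHull_subset h2 hA' hx
  · obtain ⟨x, y, hxy, b, rfl⟩ := hc
    have := mem_iff_of_reachable_cutGraph hG h1 h2 huv hu hv hxy
    cases b <;> simp [Lit.Holds] <;> tauto
  · rcases hc with ⟨x, y, z, hx, hz, hp, rfl⟩ | ⟨x, y, z, hx, hz, hp, rfl⟩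
    · have := h1.mem_of_path3 hp (hA hx)
      simp [Lit.Holds]; tauto
    · have := h2.mem_of_path3 hp (hA' hx)
      simp only [Set.mem_compl_iff] at this
      simp [Lit.Holds]; tauto
  · rcases hc with ⟨x, w, y, z, hx, hz, hp, rfl⟩ | ⟨x, w, y, z, hx, hz, hp, rfl⟩
    · have := h1.mem_of_path4 hp (hA hx)
      simp [Lit.Holds]; tauto
    · have := h2.mem_of_path4 hp (hA' hx)
      simp only [Set.mem_compl_iff] at this
      simp [Lit.Holds]; tauto
  · rcases hc with ⟨x, y, z, hxy, hx, hz, hzx, hn, rfl⟩ | ⟨x, y, z, hxy, hx, hz, hzx, hn, rfl⟩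
    · have := mem_of_adj_of_mem_tri hG h1 h2 huv hu hv hxy (mHull_subset h1 hA hx) hz hzx hn
      simp [Lit.Holds]; tauto
    · have := mem_of_adj_of_mem_tri hG h2 h1' huv.symm hv hu' hxy (mHull_subset h2 hA' hx) hz hzx hn
      simp only [Set.mem_compl_iff] at this
      simp [Lit.Holds]; tauto

theorem sat_phi_iff (hG : G.Connected) (huv : G.Adj u v) (H : Set V) :
    TwoCNF.Sat H (phi G u v) ↔ IsMHalfspace G H ∧ InCut G H u v :=
  ⟨isMHalfspace_of_sat hG huv, fun h => sat_of_isMHalfspace hG h.1 h.2⟩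

end Solutions

/-! ### Counted loops -/

/-- Run `c` with register `x` equal to `0, 1, …` below the contents of register `0`. -/
def forProg (x : ℕ) (c : Prog) : Prog :=
  .seq (.assign x (.const 0))
    (.loop (.lt (.reg x) (.reg 0)) (.seq c (.assign x (.add (.reg x) (.const 1)))))

theorem Store.setReg_reg (s : Store) (x k y : ℕ) :
    (s.setReg x k).reg y = if y = x then k else s.reg y := by
  simp [Store.setReg, Function.update_apply]

theorem Store.setArr_arr (s : Store) (a i j k b i' j' : ℕ) :
    (s.setArr a i j k).arr b i' j' = if b = a ∧ i' = i ∧ j' = j then k else s.arr b i' j' := by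
  simp only [Store.setArr, Function.update_apply]
  by_cases h1 : b = a
  · subst h1
    by_cases h2 : i' = i
    · subst h2
      simp [Function.update_apply]
    · simp [h2]
  · simp [h1]

theorem Store.setArr_arr_of_ne (s : Store) {a b : ℕ} (h : b ≠ a) (i j k : ℕ) :
    (s.setArr a i j k).arr b = s.arr b := by
  simp [Store.setArr, Function.update_of_ne h]

/-- The rule for counted loops: an invariant indexed by the loop variable, which the change of the
loop variable must not affect. -/
theorem exec_forProg {x : ℕ} {c : Prog} {N T : ℕ} (Inv : ℕ → Store → Prop)
    (hInv : ∀ i s k, Inv i s → Inv i (s.setReg x k))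
    (hN : ∀ i s, Inv i s → s.reg 0 = N)
    (hc : ∀ i s, i < N → Inv i s → s.reg x = i →
      ∃ t s', Exec c s t s' ∧ t ≤ T ∧ Inv (i + 1) s' ∧ s'.reg x = i)
    {s : Store} (hs : Inv 0 s) :
    ∃ t s', Exec (forProg x c) s t s' ∧ t ≤ (N + 1) * (T + 8) ∧ Inv N s' := by
  -- Induction on the number `d` of remaining rounds. A round costs the body plus 4 for the test and
  -- 4 for the increment; the last term 4 is the failing test.
  have key : ∀ d i s, i + d = N → Inv i s → s.reg x = i →
      ∃ t s', Exec (.loop (.lt (.reg x) (.reg 0))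
        (.seq c (.assign x (.add (.reg x) (.const 1))))) s t s' ∧ t ≤ d * (T + 8) + 4 ∧
        Inv N s' := by
    intro d
    induction d with
    | zero =>
      intro i s hi h1 h2
      refine ⟨_, s, .loop_false _ _ _ ?_, ?_, ?_⟩
      · simp [Expr.eval, h2, hN i s h1]; omega
      · simp [Expr.cost]
      · have : i = N := by omega
        exact this ▸ h1
    | succ d ih =>
      intro i s hi h1 h2
      obtain ⟨t, s', he, ht, h3, h4⟩ := hc i s (by omega) h1 h2
      obtain ⟨t', s'', he', ht', h5⟩ := ih (i + 1) (s'.setReg x (i + 1)) (by omega)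
        (hInv _ _ _ h3) (by simp [Store.setReg_reg])
      have hx1 : Exec (.assign x (.add (.reg x) (.const 1))) s' 4 (s'.setReg x (i + 1)) := by
        have := Exec.assign x (.add (.reg x) (.const 1)) s'
        simpa [Expr.eval, Expr.cost, h4] using this
      refine ⟨_, s'', .loop_true _ _ _ (s'.setReg x (i + 1)) _ _ _ ?_
        (.seq _ _ _ s' _ _ _ he hx1) he', ?_, h5⟩
      · simp [Expr.eval, h2, hN i s h1]; omega
      · simp only [Expr.cost]
        have : (d + 1) * (T + 8) = d * (T + 8) + (T + 8) := by ring
        omega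
  obtain ⟨t, s', he, ht, h⟩ := key N 0 (s.setReg x 0) (by omega) (hInv _ _ _ hs)
    (by simp [Store.setReg_reg])
  refine ⟨_, s', .seq _ _ _ (s.setReg x 0) _ _ _ (.assign x (.const 0) s) he, ?_, h⟩
  simp only [Expr.cost]
  have : (N + 1) * (T + 8) = N * (T + 8) + (T + 8) := by ring
  omega

/-! ### Definable predicates

A context describes how an environment of type `α` is kept in the memory: in registers below `k`
and arrays below `m`. A predicate on environments is definable in the context if a program decides
it in polynomial time and leaves the environment intact. -/

/-- The representation of environments in the registers below `k` and the arrays below `m`. -/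
structure Ctx (α : Type) where
  k : ℕ
  m : ℕ
  size : α → ℕ
  Rep : α → Store → Prop
  k_pos : 0 < k
  reg_zero : ∀ a s, Rep a s → s.reg 0 = size a
  rep_congr : ∀ a s s', Rep a s → (∀ x < k, s'.reg x = s.reg x) → (∀ b < m, s'.arr b = s.arr b) →
    Rep a s'

/-- `s` and `s'` agree on the registers below `k` and the arrays below `m`. -/
def Agree (k m : ℕ) (s s' : Store) : Prop :=
  (∀ x < k, s'.reg x = s.reg x) ∧ ∀ b < m, s'.arr b = s.arr b

theorem Agree.refl (k m : ℕ) (s : Store) : Agree k m s s := ⟨fun _ _ => rfl, fun _ _ => rfl⟩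

theorem Agree.trans {k m : ℕ} {s s' s'' : Store} (h : Agree k m s s') (h' : Agree k m s' s'') :
    Agree k m s s'' :=
  ⟨fun x hx => (h'.1 x hx).trans (h.1 x hx), fun x hx => (h'.2 x hx).trans (h.2 x hx)⟩

theorem Agree.mono {k m k' m' : ℕ} {s s' : Store} (h : Agree k m s s') (hk : k' ≤ k)
    (hm : m' ≤ m) : Agree k' m' s s' :=
  ⟨fun x hx => h.1 x (by omega), fun x hx => h.2 x (by omega)⟩

theorem Agree.setReg {k m : ℕ} {s s' : Store} (h : Agree k m s s') {x : ℕ} (hx : k ≤ x) (v : ℕ) :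
    Agree k m s (s'.setReg x v) :=
  ⟨fun y hy => by rw [Store.setReg_reg, if_neg (by omega), h.1 y hy], fun b hb => h.2 b hb⟩

theorem Agree.setArr {k m : ℕ} {s s' : Store} (h : Agree k m s s') {a : ℕ} (ha : m ≤ a)
    (i j v : ℕ) : Agree k m s (s'.setArr a i j v) :=
  ⟨fun y hy => h.1 y hy, fun b hb => by rw [Store.setArr_arr_of_ne _ (by omega), h.2 b hb]⟩

/-! ### Extensions of contexts and closure properties of definable predicates -/

namespace Ctx

variable {α : Type} {Γ : Ctx α}

theorem rep_of_agree {a : α} {s s' : Store} (h : Γ.Rep a s) (h' : Agree Γ.k Γ.m s s') :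
    Γ.Rep a s' :=
  Γ.rep_congr a s s' h h'.1 h'.2

/-- The context with one more number. -/
def extV (Γ : Ctx α) : Ctx (α × ℕ) where
  -- Register `Γ.k` is the result register of the outer context and accumulates during a quantifier,
  -- so it is protected too; the new number is in `Γ.k + 1`.
  k := Γ.k + 2
  m := Γ.m
  size p := Γ.size p.1
  Rep p s := Γ.Rep p.1 s ∧ s.reg (Γ.k + 1) = p.2
  k_pos := by omega
  reg_zero p s h := Γ.reg_zero _ _ h.1
  rep_congr p s s' h h1 h2 :=
    ⟨Γ.rep_congr _ _ _ h.1 (fun x hx => h1 x (by omega)) h2, by rw [h1 _ (by omega), h.2]⟩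

/-- The context with one more set of numbers below the size. -/
def extR (Γ : Ctx α) : Ctx (α × (ℕ → Prop)) where
  -- Register `Γ.k` counts the rounds of a fixed point iteration. Of the two new arrays, `Γ.m` holds
  -- the current set and `Γ.m + 1` the next stage.
  k := Γ.k + 1
  m := Γ.m + 2
  size p := Γ.size p.1
  Rep p s := Γ.Rep p.1 s ∧ ∀ i, (i < Γ.size p.1 ∧ s.arr Γ.m 0 i ≠ 0 ↔ p.2 i)
  k_pos := by omega
  reg_zero p s h := Γ.reg_zero _ _ h.1
  rep_congr p s s' h h1 h2 :=
    ⟨Γ.rep_congr _ _ _ h.1 (fun x hx => h1 x (by omega)) (fun x hx => h2 x (by omega)),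
      fun i => by rw [h2 _ (by omega), h.2]⟩

/-- The number `f a` is the value of an expression. -/
def Tm (Γ : Ctx α) (f : α → ℕ) : Prop :=
  ∃ e : Expr, ∀ a s, Γ.Rep a s → e.eval s = f a

/-- The binary relation `R a` is kept in an array. -/
def Rel (Γ : Ctx α) (R : α → ℕ → ℕ → Prop) : Prop :=
  ∃ b, ∀ a s, Γ.Rep a s → ∀ i j, s.arr b i j ≠ 0 ↔ R a i j

/-- The set `X a` is kept in an array. -/
def Sub (Γ : Ctx α) (X : α → ℕ → Prop) : Prop :=
  ∃ b, ∀ a s, Γ.Rep a s → ∀ i, (i < Γ.size a ∧ s.arr b 0 i ≠ 0 ↔ X a i)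

/-- A program decides `P` in polynomial time. -/
def Def (Γ : Ctx α) (P : α → Prop) : Prop :=
  ∃ (c : Prog) (p : Polynomial ℕ), ∀ a s, Γ.Rep a s → ∃ t s', Exec c s t s' ∧
    t ≤ p.eval (Γ.size a) ∧ Agree Γ.k Γ.m s s' ∧ (s'.reg Γ.k ≠ 0 ↔ P a)

theorem Tm.const (k : ℕ) : Tm Γ fun _ => k := ⟨.const k, fun _ _ _ => rfl⟩

theorem Tm.size : Tm Γ Γ.size := ⟨.reg 0, fun a s h => Γ.reg_zero a s h⟩

theorem Tm.add {f g : α → ℕ} (hf : Tm Γ f) (hg : Tm Γ g) : Tm Γ fun a => f a + g a := by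
  obtain ⟨e, he⟩ := hf
  obtain ⟨e', he'⟩ := hg
  exact ⟨.add e e', fun a s h => by simp [Expr.eval, he a s h, he' a s h]⟩

theorem Tm.var : Tm Γ.extV fun p => p.2 := ⟨.reg (Γ.k + 1), fun _ _ h => h.2⟩

theorem Tm.v {f : α → ℕ} (hf : Tm Γ f) : Tm Γ.extV fun p => f p.1 := by
  obtain ⟨e, he⟩ := hf
  exact ⟨e, fun a s h => he a.1 s h.1⟩

theorem Tm.r {f : α → ℕ} (hf : Tm Γ f) : Tm Γ.extR fun p => f p.1 := by
  obtain ⟨e, he⟩ := hf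
  exact ⟨e, fun a s h => he a.1 s h.1⟩

theorem Rel.v {R : α → ℕ → ℕ → Prop} (hf : Rel Γ R) : Rel Γ.extV fun p => R p.1 := by
  obtain ⟨e, he⟩ := hf
  exact ⟨e, fun a s h => he a.1 s h.1⟩

theorem Rel.r {R : α → ℕ → ℕ → Prop} (hf : Rel Γ R) : Rel Γ.extR fun p => R p.1 := by
  obtain ⟨e, he⟩ := hf
  exact ⟨e, fun a s h => he a.1 s h.1⟩

theorem Sub.var : Sub Γ.extR fun p => p.2 := ⟨Γ.m, fun _ _ h => h.2⟩

theorem Sub.v {X : α → ℕ → Prop} (hf : Sub Γ X) : Sub Γ.extV fun p => X p.1 := by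
  obtain ⟨e, he⟩ := hf
  exact ⟨e, fun a s h => he a.1 s h.1⟩

theorem Def.of_expr {P : α → Prop} (e : Expr) (h : ∀ a s, Γ.Rep a s → (e.eval s ≠ 0 ↔ P a)) :
    Def Γ P := by
  refine ⟨.assign Γ.k e, Polynomial.C (e.cost + 1), fun a s hs =>
    ⟨_, _, .assign Γ.k e s, by simp, (Agree.refl _ _ _).setReg le_rfl _, ?_⟩⟩
  rw [Store.setReg_reg, if_pos rfl, h a s hs]

theorem Def.congr {P Q : α → Prop} (h : Def Γ P) (hPQ : ∀ a, P a ↔ Q a) : Def Γ Q := by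
  have : P = Q := funext fun a => propext (hPQ a)
  exact this ▸ h

theorem Tm.lt {f g : α → ℕ} (hf : Tm Γ f) (hg : Tm Γ g) : Def Γ fun a => f a < g a := by
  obtain ⟨e, he⟩ := hf
  obtain ⟨e', he'⟩ := hg
  exact .of_expr (.lt e e') fun a s h => by simp [Expr.eval, he a s h, he' a s h]

theorem Tm.eq {f g : α → ℕ} (hf : Tm Γ f) (hg : Tm Γ g) : Def Γ fun a => f a = g a := by
  obtain ⟨e, he⟩ := hf
  obtain ⟨e', he'⟩ := hg
  exact .of_expr (.eq e e') fun a s h => by simp [Expr.eval, he a s h, he' a s h]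

theorem Rel.app {R : α → ℕ → ℕ → Prop} (hR : Rel Γ R) {f g : α → ℕ} (hf : Tm Γ f) (hg : Tm Γ g) :
    Def Γ fun a => R a (f a) (g a) := by
  obtain ⟨e, he⟩ := hf
  obtain ⟨e', he'⟩ := hg
  obtain ⟨b, hb⟩ := hR
  exact .of_expr (.read b e e') fun a s h => by
    simp only [Expr.eval, he a s h, he' a s h]; exact hb a s h _ _

theorem Def.not {P : α → Prop} (hP : Def Γ P) : Def Γ fun a => ¬ P a := by
  obtain ⟨c, p, h⟩ := hP
  refine ⟨.seq c (.assign Γ.k (.eq (.reg Γ.k) (.const 0))), p + Polynomial.C 4, fun a s hs => ?_⟩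
  obtain ⟨t, s', he, ht, ha, hr⟩ := h a s hs
  refine ⟨_, _, .seq _ _ _ _ _ _ _ he (.assign _ _ _), ?_, ha.setReg le_rfl _, ?_⟩
  · simp [Expr.cost]; omega
  · by_cases h0 : s'.reg Γ.k = 0 <;> simp [Store.setReg_reg, ← hr, Expr.eval, h0]

theorem Def.and {P Q : α → Prop} (hP : Def Γ P) (hQ : Def Γ Q) : Def Γ fun a => P a ∧ Q a := by
  obtain ⟨c, p, h⟩ := hP
  obtain ⟨d, q, h'⟩ := hQ
  -- If `P` fails, the result register already holds zero and nothing is left to do.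
  refine ⟨.seq c (.branch (.reg Γ.k) d .skip), p + q + Polynomial.C 4, fun a s hs => ?_⟩
  obtain ⟨t, s', he, ht, ha, hr⟩ := h a s hs
  obtain ⟨t', s'', he', ht', ha', hr'⟩ := h' a s' (rep_of_agree hs ha)
  by_cases hPa : P a
  · refine ⟨_, _, .seq _ _ _ _ _ _ _ he (.branch_true _ _ _ _ _ _ (hr.2 hPa) he'), ?_,
      ha.trans ha', ?_⟩
    · simp [Expr.cost]; omega
    · rw [hr']; simp [hPa]
  · have h0 : s'.reg Γ.k = 0 := by by_contra h0; exact hPa (hr.1 h0)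
    refine ⟨_, _, .seq _ _ _ _ _ _ _ he (.branch_false _ _ _ _ _ _ h0 (.skip _)), ?_, ha, ?_⟩
    · simp [Expr.cost]; omega
    · simp [h0, hPa]

theorem Def.or {P Q : α → Prop} (hP : Def Γ P) (hQ : Def Γ Q) : Def Γ fun a => P a ∨ Q a :=
  (hP.not.and hQ.not).not.congr fun a => by tauto

theorem Tm.ne {f g : α → ℕ} (hf : Tm Γ f) (hg : Tm Γ g) : Def Γ fun a => f a ≠ g a :=
  (hf.eq hg).not

/-- The entries of the array at and beyond the size are arbitrary, so the index is compared with the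
size before the entry is read. -/
theorem Sub.app {X : α → ℕ → Prop} (hX : Sub Γ X) {f : α → ℕ} (hf : Tm Γ f) :
    Def Γ fun a => X a (f a) := by
  have h1 : Def Γ fun a => f a < Γ.size a := hf.lt .size
  obtain ⟨c, p, h⟩ := h1
  obtain ⟨e, he⟩ := hf
  obtain ⟨b, hb⟩ := hX
  refine ⟨.seq c (.branch (.reg Γ.k) (.assign Γ.k (.read b (.const 0) e)) .skip),
    p + Polynomial.C (e.cost + 7), fun a s hs => ?_⟩
  obtain ⟨t, s', hc, ht, ha, hr⟩ := h a s hs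
  have hs' := rep_of_agree hs ha
  by_cases hlt : f a < Γ.size a
  · refine ⟨_, _, .seq _ _ _ _ _ _ _ hc (.branch_true _ _ _ _ _ _ (hr.2 hlt) (.assign _ _ _)), ?_,
      ha.setReg le_rfl _, ?_⟩
    · simp [Expr.cost]; omega
    · simp [Store.setReg_reg, ← hb a s' hs', Expr.eval, he a s' hs', hlt]
  · have h0 : s'.reg Γ.k = 0 := by by_contra h0; exact hlt (hr.1 h0)
    refine ⟨_, _, .seq _ _ _ _ _ _ _ hc (.branch_false _ _ _ _ _ _ h0 (.skip _)), ?_, ha, ?_⟩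
    · simp [Expr.cost]; omega
    · simp [← hb a s' hs', h0, hlt]

theorem Def.ex {P : α → ℕ → Prop} (hP : Def Γ.extV fun p => P p.1 p.2) :
    Def Γ fun a => ∃ i < Γ.size a, P a i := by
  obtain ⟨c, p, h⟩ := hP
  -- Register `Γ.k` records whether a witness has been found, `Γ.k + 1` runs through the candidates,
  -- and `Γ.k + 2` is the result register of the body. In the bound, 12 is 4 for the branch and 8
  -- for the loop.
  refine ⟨.seq (.assign Γ.k (.const 0)) (forProg (Γ.k + 1)
    (.seq c (.branch (.reg (Γ.k + 2)) (.assign Γ.k (.const 1)) .skip))),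
    (Polynomial.X + Polynomial.C 1) * (p + Polynomial.C 12) + Polynomial.C 2, fun a s hs => ?_⟩
  refine (exec_forProg (x := Γ.k + 1)
    (c := .seq c (.branch (.reg (Γ.k + 2)) (.assign Γ.k (.const 1)) .skip))
    (N := Γ.size a) (T := p.eval (Γ.size a) + 4)
    (fun i s' => Agree Γ.k Γ.m s s' ∧ (s'.reg Γ.k ≠ 0 ↔ ∃ j < i, P a j)) ?_ ?_ ?_
    (s := s.setReg Γ.k 0) ?_).elim
    fun t ⟨s', he, ht, hI⟩ => ?_
  rotate_right
  · refine ⟨_, s', .seq _ _ _ _ _ _ _ (.assign _ _ _) he, ?_, hI.1, hI.2⟩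
    simp only [Expr.cost, Polynomial.eval_add, Polynomial.eval_mul, Polynomial.eval_X,
      Polynomial.eval_C]
    have : p.eval (Γ.size a) + 4 + 8 = p.eval (Γ.size a) + 12 := by omega
    rw [this] at ht
    omega
  · intro i s' k ⟨h1, h2⟩
    refine ⟨h1.setReg (by omega) _, ?_⟩
    rw [Store.setReg_reg, if_neg (by omega), h2]
  · intro i s' ⟨h1, _⟩
    exact Γ.reg_zero a s' (rep_of_agree hs h1)
  · intro i s' hi ⟨h1, h2⟩ h3
    obtain ⟨t, s'', he, ht, ha, hr⟩ := h (a, i) s' ⟨rep_of_agree hs h1, h3⟩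
    have hk : s''.reg Γ.k = s'.reg Γ.k := ha.1 _ (by simp [extV])
    have hk1 : s''.reg (Γ.k + 1) = s'.reg (Γ.k + 1) := ha.1 _ (by simp [extV])
    have ha' : Agree Γ.k Γ.m s s'' := h1.trans (ha.mono (by simp [extV]) le_rfl)
    change t ≤ p.eval (Γ.size a) at ht
    change s''.reg (Γ.k + 2) ≠ 0 ↔ P a i at hr
    by_cases hPi : P a i
    · refine ⟨_, _, .seq _ _ _ _ _ _ _ he (.branch_true _ _ _ _ _ _ (hr.2 hPi) (.assign _ _ _)),
        ?_, ⟨ha'.setReg le_rfl _, ?_⟩, ?_⟩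
      · simp [Expr.cost]; omega
      · simp only [Store.setReg_reg, Expr.eval, if_true, ne_eq, one_ne_zero, not_false_eq_true,
          true_iff]
        exact ⟨i, by omega, hPi⟩
      · rw [Store.setReg_reg, if_neg (by omega), hk1, h3]
    · have h0 : s''.reg (Γ.k + 2) = 0 := by by_contra h0; exact hPi (hr.1 h0)
      refine ⟨_, _, .seq _ _ _ _ _ _ _ he (.branch_false _ _ _ _ _ _ h0 (.skip _)),
        ?_, ⟨ha', ?_⟩, ?_⟩
      · simp [Expr.cost]; omega
      · rw [hk, h2]
        constructor
        · rintro ⟨j, hj, hPj⟩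
          exact ⟨j, by omega, hPj⟩
        · rintro ⟨j, hj, hPj⟩
          rcases Nat.lt_succ_iff_lt_or_eq.1 hj with hj | rfl
          · exact ⟨j, hj, hPj⟩
          · exact absurd hPj hPi
      · rw [hk1, h3]
  · refine ⟨(Agree.refl _ _ _).setReg le_rfl _, ?_⟩
    simp [Store.setReg_reg]

theorem Def.all {P : α → ℕ → Prop} (hP : Def Γ.extV fun p => P p.1 p.2) :
    Def Γ fun a => ∀ i < Γ.size a, P a i :=
  (Def.ex (P := fun a i => ¬ P a i) hP.not).not.congr fun a => by push Not; rfl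

end Ctx

/-! ### Inflationary fixed points -/

/-- The stages of the inflationary iteration of `F` on sets of numbers below `N`. -/
def ifpStage (N : ℕ) (F : (ℕ → Prop) → ℕ → Prop) : ℕ → ℕ → Prop
  | 0 => fun _ => False
  | t + 1 => fun i => i < N ∧ (ifpStage N F t i ∨ F (ifpStage N F t) i)

/-- The inflationary fixed point of `F` on the numbers below `N`. -/
def ifp (N : ℕ) (F : (ℕ → Prop) → ℕ → Prop) : ℕ → Prop := ifpStage N F N

theorem ifpStage_lt {N : ℕ} {F : (ℕ → Prop) → ℕ → Prop} {t i : ℕ} (h : ifpStage N F t i) :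
    i < N := by
  cases t with
  | zero => exact h.elim
  | succ t => exact h.1

theorem ifp_lt {N : ℕ} {F : (ℕ → Prop) → ℕ → Prop} {i : ℕ} (h : ifp N F i) : i < N :=
  ifpStage_lt h

/-- This is how soundness is proved: an invariant of a single stage passes to the fixed point. -/
theorem ifp_induction {N : ℕ} {F : (ℕ → Prop) → ℕ → Prop} (Q : (ℕ → Prop) → Prop)
    (h0 : Q fun _ => False)
    (hs : ∀ X : ℕ → Prop, (∀ i, X i → i < N) → Q X → Q fun i => i < N ∧ (X i ∨ F X i)) :
    Q (ifp N F) := by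
  have : ∀ t, Q (ifpStage N F t) := by
    intro t
    induction t with
    | zero => exact h0
    | succ t ih => exact hs _ (fun _ => ifpStage_lt) ih
  exact this N

/-- The stages increase, so until they become stationary each one adds a number below `N`, and `N`
stages are enough. Monotonicity of `F` plays no role, which is essential for `greedy2`. -/
theorem ifp_closed {N : ℕ} {F : (ℕ → Prop) → ℕ → Prop} {i : ℕ} (hi : i < N)
    (h : F (ifp N F) i) : ifp N F i := by
  classical
  by_contra hcon
  let S : ℕ → Finset ℕ := fun t => (Finset.range N).filter (ifpStage N F t)
  have mem : ∀ t j, j ∈ S t ↔ ifpStage N F t j := fun t j => by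
    simp only [S, Finset.mem_filter, Finset.mem_range]
    exact ⟨fun h => h.2, fun h => ⟨ifpStage_lt h, h⟩⟩
  have grow : ∀ t, ifpStage N F t = ifpStage N F (t + 1) ∨ (S t).card < (S (t + 1)).card := by
    intro t
    by_cases heq : S t = S (t + 1)
    · left
      funext j
      rw [← mem, ← mem, heq]
    · right
      refine Finset.card_lt_card ((Finset.ssubset_iff_subset_ne).2 ⟨fun j hj => ?_, heq⟩)
      rw [mem] at hj ⊢
      exact ⟨ifpStage_lt hj, .inl hj⟩
  have stay : ∀ t d, ifpStage N F t = ifpStage N F (t + 1) →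
      ifpStage N F (t + d) = ifpStage N F t := by
    intro t d ht
    induction d with
    | zero => rfl
    | succ d ih =>
      funext j
      rw [← Nat.add_assoc]
      simp only [ifpStage]
      rw [ih]
      exact (congrFun ht j).symm
  -- Either the iteration is stationary by stage `N`, or the first `t` stages were all strict and
  -- have produced `t` elements.
  have big : ∀ t ≤ N, ifpStage N F N = ifpStage N F (N + 1) ∨ t ≤ (S t).card := by
    intro t
    induction t with
    | zero => intro _; right; omega
    | succ t ih =>
      intro ht
      rcases ih (by omega) with h | h
      · exact .inl h
      · rcases grow t with h' | h'
        · left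
          have e1 := stay t (N - t) h'
          have e2 := stay t (N + 1 - t) h'
          rw [Nat.add_sub_cancel' (by omega)] at e1 e2
          rw [e1, e2]
        · right; omega
  rcases big N le_rfl with h' | h'
  · apply hcon
    unfold ifp
    rw [h']
    exact ⟨hi, .inr h⟩
  · have hsub : S N ⊆ (Finset.range N).erase i := by
      intro j hj
      rw [mem] at hj
      refine Finset.mem_erase.2 ⟨?_, Finset.mem_range.2 (ifpStage_lt hj)⟩
      rintro rfl
      exact hcon hj
    have := Finset.card_le_card hsub
    rw [Finset.card_erase_of_mem (Finset.mem_range.2 hi), Finset.card_range] at this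
    omega

/-! ### Computing inflationary fixed points on the machine -/

namespace Ctx

variable {α : Type} {Γ : Ctx α}

/-- The evaluation of one stage of an inflationary fixed point, into the array `m + 1`. -/
theorem exec_stage {F : α → (ℕ → Prop) → ℕ → Prop} {c : Prog} {p : Polynomial ℕ}
    (h : ∀ q s, Γ.extR.extV.Rep q s → ∃ t s', Exec c s t s' ∧
      t ≤ p.eval (Γ.extR.extV.size q) ∧ Agree Γ.extR.extV.k Γ.extR.extV.m s s' ∧
      (s'.reg Γ.extR.extV.k ≠ 0 ↔ F q.1.1 q.1.2 q.2))
    {a : α} {X : ℕ → Prop} {s : Store} (hs : Γ.extR.Rep (a, X) s) :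
    ∃ t s', Exec (forProg (Γ.k + 2) (.seq c (.write (Γ.m + 1) (.const 0) (.reg (Γ.k + 2))
        (.add (.read Γ.m (.const 0) (.reg (Γ.k + 2))) (.reg (Γ.k + 3)))))) s t s' ∧
      t ≤ (Γ.size a + 1) * (p.eval (Γ.size a) + 16) ∧ Agree (Γ.k + 1) (Γ.m + 1) s s' ∧
      ∀ i < Γ.size a, (s'.arr (Γ.m + 1) 0 i ≠ 0 ↔ X i ∨ F a X i) := by
  -- The sweep leaves the array `Γ.m` alone, so every test sees the old set `X`. The sum of the old
  -- entry and the result of the test is nonzero exactly if one of them is. The write costs 8, hence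
  -- 16 with the loop.
  refine (exec_forProg (x := Γ.k + 2)
    (c := .seq c (.write (Γ.m + 1) (.const 0) (.reg (Γ.k + 2))
        (.add (.read Γ.m (.const 0) (.reg (Γ.k + 2))) (.reg (Γ.k + 3)))))
    (N := Γ.size a) (T := p.eval (Γ.size a) + 8)
    (fun i s' => Agree (Γ.k + 1) (Γ.m + 1) s s' ∧
      ∀ j < i, (s'.arr (Γ.m + 1) 0 j ≠ 0 ↔ X j ∨ F a X j)) ?_ ?_ ?_ (s := s) ?_).elim
    fun t ⟨s', he, ht, hI⟩ => ?_
  rotate_right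
  · exact ⟨t, s', he, ht, hI⟩
  · exact fun i s' k ⟨h1, h2⟩ => ⟨h1.setReg (by omega) _, h2⟩
  · intro i s' ⟨h1, _⟩
    exact Γ.reg_zero a s' (rep_of_agree hs.1 (h1.mono (by omega) (by omega)))
  · intro i s' hi ⟨h1, h2⟩ h3
    have hs' : Γ.extR.Rep (a, X) s' :=
      ⟨rep_of_agree hs.1 (h1.mono (by omega) (by omega)), fun j => by
        rw [h1.2 Γ.m (by omega)]; exact hs.2 j⟩
    obtain ⟨t, s'', he, ht, ha, hr⟩ := h ((a, X), i) s' ⟨hs', h3⟩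
    change t ≤ p.eval (Γ.size a) at ht
    change s''.reg (Γ.k + 3) ≠ 0 ↔ F a X i at hr
    have hk2 : s''.reg (Γ.k + 2) = i := (ha.1 _ (by simp [extV, extR])).trans h3
    have hXi : s''.arr Γ.m 0 i ≠ 0 ↔ X i := by
      rw [ha.2 Γ.m (by simp [extV, extR])]
      exact (and_iff_right hi).symm.trans (hs'.2 i)
    refine ⟨_, _, .seq _ _ _ _ _ _ _ he (.write _ _ _ _ _), ?_,
      ⟨(h1.trans (ha.mono (by simp [extV, extR]) (by simp [extV, extR]))).setArr le_rfl _ _ _, ?_⟩,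
      hk2⟩
    · simp [Expr.cost]; omega
    · intro j hj
      rw [Store.setArr_arr]
      simp only [Expr.eval, hk2, true_and]
      split_ifs with hji
      · subst hji
        rw [← hXi, ← hr]
        omega
      · rw [ha.2 _ (by simp [extV, extR])]
        exact h2 j (by omega)
  · exact ⟨Agree.refl _ _ _, by simp⟩

/-- Copying row `0` of the array `m + 1` to the array `m`. -/
theorem exec_copy {a : α} {s : Store} (hs : Γ.Rep a s) :
    ∃ t s', Exec (forProg (Γ.k + 2) (.write Γ.m (.const 0) (.reg (Γ.k + 2))
        (.read (Γ.m + 1) (.const 0) (.reg (Γ.k + 2))))) s t s' ∧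
      t ≤ (Γ.size a + 1) * 16 ∧ Agree (Γ.k + 1) Γ.m s s' ∧
      ∀ i < Γ.size a, s'.arr Γ.m 0 i = s.arr (Γ.m + 1) 0 i := by
  refine (exec_forProg (x := Γ.k + 2)
    (c := .write Γ.m (.const 0) (.reg (Γ.k + 2)) (.read (Γ.m + 1) (.const 0) (.reg (Γ.k + 2))))
    (N := Γ.size a) (T := 8)
    (fun i s' => Agree (Γ.k + 1) Γ.m s s' ∧ s'.arr (Γ.m + 1) = s.arr (Γ.m + 1) ∧
      ∀ j < i, s'.arr Γ.m 0 j = s.arr (Γ.m + 1) 0 j) ?_ ?_ ?_ (s := s) ?_).elim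
    fun t ⟨s', he, ht, hI⟩ => ?_
  rotate_right
  · exact ⟨t, s', he, ht, hI.1, hI.2.2⟩
  · exact fun i s' k ⟨h1, h2⟩ => ⟨h1.setReg (by omega) _, h2⟩
  · intro i s' ⟨h1, _⟩
    exact Γ.reg_zero a s' (rep_of_agree hs (h1.mono (by omega) (by omega)))
  · intro i s' hi ⟨h1, h2, h3⟩ h4
    refine ⟨_, _, .write _ _ _ _ _, ?_, ⟨h1.setArr le_rfl _ _ _, ?_, ?_⟩, h4⟩
    · simp [Expr.cost]
    · rw [Store.setArr_arr_of_ne _ (by omega), h2]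
    · intro j hj
      rw [Store.setArr_arr]
      simp only [Expr.eval, h4, true_and]
      split_ifs with hji
      · rw [hji, h2]
      · exact h3 j (by omega)
  · exact ⟨Agree.refl _ _ _, rfl, by simp⟩

/-- Clearing row `0` of the array `m`. -/
theorem exec_clear {a : α} {s : Store} (hs : Γ.Rep a s) :
    ∃ t s', Exec (forProg (Γ.k + 2) (.write Γ.m (.const 0) (.reg (Γ.k + 2)) (.const 0))) s t s' ∧
      t ≤ (Γ.size a + 1) * 16 ∧ Agree (Γ.k + 1) Γ.m s s' ∧
      ∀ i < Γ.size a, s'.arr Γ.m 0 i = 0 := by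
  refine (exec_forProg (x := Γ.k + 2)
    (c := .write Γ.m (.const 0) (.reg (Γ.k + 2)) (.const 0))
    (N := Γ.size a) (T := 8)
    (fun i s' => Agree (Γ.k + 1) Γ.m s s' ∧ ∀ j < i, s'.arr Γ.m 0 j = 0) ?_ ?_ ?_ (s := s) ?_).elim
    fun t ⟨s', he, ht, hI⟩ => ?_
  rotate_right
  · exact ⟨t, s', he, ht, hI⟩
  · exact fun i s' k ⟨h1, h2⟩ => ⟨h1.setReg (by omega) _, h2⟩
  · intro i s' ⟨h1, _⟩
    exact Γ.reg_zero a s' (rep_of_agree hs (h1.mono (by omega) (by omega)))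
  · intro i s' hi ⟨h1, h3⟩ h4
    refine ⟨_, _, .write _ _ _ _ _, ?_, ⟨h1.setArr le_rfl _ _ _, ?_⟩, h4⟩
    · simp [Expr.cost]
    · intro j hj
      rw [Store.setArr_arr]
      simp only [Expr.eval, h4, true_and]
      split_ifs with hji
      · rfl
      · exact h3 j (by omega)
  · exact ⟨Agree.refl _ _ _, by simp⟩

/-- The set starts empty, is replaced by its next stage as many times as the size, and is finally
queried at `f a`. Each stage decides `F` once for every number below the size, so the time stays
polynomial. -/
theorem Def.ifp {F : α → (ℕ → Prop) → ℕ → Prop}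
    (hF : Def Γ.extR.extV fun q => F q.1.1 q.1.2 q.2) {f : α → ℕ} (hf : Tm Γ f) :
    Def Γ fun a => ifp (Γ.size a) (F a) (f a) := by
  obtain ⟨c, p, h⟩ := hF
  have hread : Def Γ.extR fun q => q.2 (f q.1) := Sub.app .var hf.r
  obtain ⟨d, pd, hd⟩ := hread
  let stage : Prog := forProg (Γ.k + 2) (.seq c (.write (Γ.m + 1) (.const 0) (.reg (Γ.k + 2))
        (.add (.read Γ.m (.const 0) (.reg (Γ.k + 2))) (.reg (Γ.k + 3)))))
  let copy : Prog := forProg (Γ.k + 2) (.write Γ.m (.const 0) (.reg (Γ.k + 2))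
        (.read (Γ.m + 1) (.const 0) (.reg (Γ.k + 2))))
  let clear : Prog := forProg (Γ.k + 2) (.write Γ.m (.const 0) (.reg (Γ.k + 2)) (.const 0))
  let X : Polynomial ℕ := Polynomial.X + Polynomial.C 1
  -- The query `d` lives in the extended context and reports in register `Γ.k + 1`; the last
  -- assignment moves its answer to `Γ.k`, which is free again after the loop.
  refine ⟨.seq clear (.seq (forProg Γ.k (.seq stage copy)) (.seq d (.assign Γ.k (.reg (Γ.k + 1))))),
    X * Polynomial.C 16 + (X * (X * (p + Polynomial.C 16) + X * Polynomial.C 16 + Polynomial.C 8)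
      + (pd + Polynomial.C 2)),
    fun a s hs => ?_⟩
  obtain ⟨t1, s1, he1, ht1, ha1, hz1⟩ := exec_clear hs
  have hs1 : Γ.Rep a s1 := rep_of_agree hs (ha1.mono (by omega) le_rfl)
  refine (exec_forProg (x := Γ.k)
    (c := .seq stage copy) (N := Γ.size a)
    (T := (Γ.size a + 1) * (p.eval (Γ.size a) + 16) + (Γ.size a + 1) * 16)
    (fun t s' => Agree Γ.k Γ.m s1 s' ∧
      ∀ i, (i < Γ.size a ∧ s'.arr Γ.m 0 i ≠ 0 ↔ ifpStage (Γ.size a) (F a) t i)) ?_ ?_ ?_ (s := s1) ?_).elim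
    fun t2 ⟨s2, he2, ht2, ha2, hr2⟩ => ?_
  rotate_right
  · have hs2 : Γ.extR.Rep (a, Mono.ifp (Γ.size a) (F a)) s2 := ⟨rep_of_agree hs1 ha2, hr2⟩
    obtain ⟨t3, s3, he3, ht3, ha3, hr3⟩ := hd _ _ hs2
    refine ⟨_, _, .seq _ _ _ _ _ _ _ he1 (.seq _ _ _ _ _ _ _ he2 (.seq _ _ _ _ _ _ _ he3
      (.assign _ _ _))), ?_, ?_, ?_⟩
    · simp only [Expr.cost, Polynomial.eval_add, Polynomial.eval_mul, Polynomial.eval_X,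
        Polynomial.eval_C, X]
      change t3 ≤ pd.eval (Γ.size a) at ht3
      omega
    · exact ((ha1.mono (by omega) le_rfl).trans (ha2.trans
        (ha3.mono (by simp [extR]) (by simp [extR])))).setReg le_rfl _
    · rw [Store.setReg_reg, if_pos rfl]
      exact hr3
  · intro t s' k ⟨h1, h2⟩
    exact ⟨h1.setReg le_rfl _, h2⟩
  · intro t s' ⟨h1, _⟩
    exact Γ.reg_zero a s' (rep_of_agree hs1 h1)
  · intro t s' ht ⟨h1, h2⟩ h3
    have hs' : Γ.extR.Rep (a, ifpStage (Γ.size a) (F a) t) s' := ⟨rep_of_agree hs1 h1, h2⟩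
    obtain ⟨t4, s4, he4, ht4, ha4, hr4⟩ := exec_stage h hs'
    have hs4 := rep_of_agree hs'.1 (ha4.mono (by omega) (by omega))
    obtain ⟨t5, s5, he5, ht5, ha5, hr5⟩ := exec_copy hs4
    refine ⟨_, s5, .seq _ _ _ _ _ _ _ he4 he5, Nat.add_le_add ht4 ht5, ⟨?_, ?_⟩, ?_⟩
    · exact h1.trans ((ha4.mono (by omega) (by omega)).trans (ha5.mono (by omega) le_rfl))
    · intro i
      simp only [ifpStage]
      refine and_congr_right fun hi => ?_
      rw [hr5 i hi]
      exact hr4 i hi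
    · rw [ha5.1 _ (by omega), ha4.1 _ (by omega), h3]
  · refine ⟨Agree.refl _ _ _, fun i => ?_⟩
    simp only [ifpStage, iff_false, not_and, not_not]
    exact hz1 i

end Ctx

/-! ### The formula on numbered vertices and literals

The following predicates describe the sets and relations of the algorithm on numbers. The
parameter `N` bounds all quantifiers, `R` is the adjacency relation, and the literals `x ∈ H` and
`x ∉ H` have the numbers `x + x + 1` and `x + x`. -/

section NumberPredicates

variable (N : ℕ) (R : ℕ → ℕ → Prop)

/-- `b` is reached from `a` by steps of `E`. -/
def reachN (E : ℕ → ℕ → Prop) (a b : ℕ) : Prop :=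
  ifp N (fun X y => y = a ∨ ∃ z < N, X z ∧ E z y) b

def triN (u v x : ℕ) : Prop := R u x ∧ R v x

def squareN (u v x : ℕ) : Prop :=
  x = u ∨ x = v ∨
    ∃ a < N, ∃ b < N, R u a ∧ R a b ∧ R b v ∧ a ≠ v ∧ b ≠ u ∧ (x = a ∨ x = b)

/-- Modelled on `mem_sideA_iff`, so that no distances have to be computed. -/
def sideAN (u v x : ℕ) : Prop :=
  x = u ∨ R u x ∧ ¬ R v x ∧ x ≠ v ∧ ∃ b < N, R x b ∧ R b v ∧ b ≠ u

/-- The edges into vertices outside the closed neighbourhood of `x`. -/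
def farEdge (x i j : ℕ) : Prop := R i j ∧ j ≠ x ∧ ¬ R x j

/-- The convex hull of `A^u`, computed by adding second vertices of induced paths. -/
def hullN (u v w : ℕ) : Prop :=
  ifp N (fun X w => sideAN N R u v w ∨ ∃ x < N, ∃ y < N, ∃ z < N, X x ∧ X y ∧ x ≠ y ∧ ¬ R x y ∧
    R x w ∧ R w z ∧ z ≠ x ∧ ¬ R x z ∧ reachN N (farEdge R x) z y) w

def cutN (u v i j : ℕ) : Prop :=
  R i j ∧ ¬ ((squareN N R u v i ∨ triN R u v i) ∧ (squareN N R u v j ∨ triN R u v j))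

def phiTriN (u v l l' : ℕ) : Prop :=
  ∃ x < N, ∃ y < N, triN R u v x ∧ triN R u v y ∧ x ≠ y ∧ ¬ R x y ∧
    (l = x + x + 1 ∧ l' = y + y + 1 ∨ l = x + x ∧ l' = y + y)

def phiConvN (u v l l' : ℕ) : Prop :=
  ∃ x < N, (hullN N R u v x ∧ l = x + x + 1 ∧ l' = x + x + 1) ∨
    (hullN N R v u x ∧ l = x + x ∧ l' = x + x)

/-- Since `reachN` is reflexive and `N` exceeds the number `n` of vertices, the condition `x < n` is
needed to exclude numbers that are not vertices. -/
def phiTN (n u v l l' : ℕ) : Prop :=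
  ∃ x < N, ∃ y < N, x < n ∧ reachN N (cutN N R u v) x y ∧
    (l = x + x + 1 ∧ l' = y + y ∨ l = x + x ∧ l' = y + y + 1)

/-- The bits `b` and `b'` are the signs of the two literals, so one predicate serves both
orientations of the edge. -/
def phi3N (b b' u v l l' : ℕ) : Prop :=
  ∃ x < N, ∃ y < N, ∃ z < N, sideAN N R u v x ∧ triN R u v z ∧ R x y ∧ R y z ∧ x ≠ z ∧ ¬ R x z ∧
    l = y + y + b ∧ l' = z + z + b'

def phi4N (b b' u v l l' : ℕ) : Prop :=
  ∃ x < N, ∃ w < N, ∃ y < N, ∃ z < N, sideAN N R u v x ∧ triN R u v z ∧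
    R x w ∧ R w y ∧ R y z ∧ x ≠ y ∧ x ≠ z ∧ w ≠ z ∧ ¬ R x y ∧ ¬ R x z ∧ ¬ R w z ∧
    l = y + y + b ∧ l' = z + z + b'

def phiAN (b b' u v l l' : ℕ) : Prop :=
  ∃ x < N, ∃ y < N, ∃ z < N, R x y ∧ hullN N R u v x ∧ triN R u v z ∧ z ≠ x ∧ ¬ R x z ∧
    l = y + y + b ∧ l' = z + z + b'

def phiN (n u v l l' : ℕ) : Prop :=
  phiTriN N R u v l l' ∨ phiConvN N R u v l l' ∨ phiTN N R n u v l l' ∨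
    phi3N N R 1 0 u v l l' ∨ phi3N N R 0 1 v u l l' ∨
    phi4N N R 1 0 u v l l' ∨ phi4N N R 0 1 v u l l' ∨
    phiAN N R 1 0 u v l l' ∨ phiAN N R 0 1 v u l l'

/-- The unit clauses of the sample. -/
def sampleN (T : ℕ → ℕ → Prop) (l l' : ℕ) : Prop :=
  ∃ x < N, T 0 x ∧
    (T 1 x ∧ l = x + x + 1 ∧ l' = x + x + 1 ∨ ¬ T 1 x ∧ l = x + x ∧ l' = x + x)

def clauseN (T : ℕ → ℕ → Prop) (n u v l l' : ℕ) : Prop :=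
  phiN N R n u v l l' ∨ sampleN N T l l'

/-- The literals `l` and `l'` are complementary. -/
def compl2 (l l' : ℕ) : Prop :=
  ∃ x < N, l = x + x ∧ l' = x + x + 1 ∨ l = x + x + 1 ∧ l' = x + x

/-- The edges of the implication graph of the clauses `C`. -/
def implies2 (C : ℕ → ℕ → Prop) (l m : ℕ) : Prop :=
  ∃ l' < N, compl2 N l l' ∧ (C l' m ∨ C m l')

/-- No literal is equivalent to its complement. -/
def sat2 (C : ℕ → ℕ → Prop) : Prop :=
  ∀ l < N, ∀ l' < N, ¬ (compl2 N l l' ∧ reachN N (implies2 N C) l l' ∧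
    reachN N (implies2 N C) l' l)

/-- The variable of the literal `m` is undecided by `X`, and `m` may be made true. -/
def candidate2 (C : ℕ → ℕ → Prop) (X : ℕ → Prop) (m : ℕ) : Prop :=
  ∃ m' < N, compl2 N m m' ∧ ¬ X m ∧ ¬ X m' ∧ ¬ reachN N (implies2 N C) m m'

/-- The literals that are true in a greedy solution. -/
def greedy2 (C : ℕ → ℕ → Prop) (l : ℕ) : Prop :=
  ifp N (fun X l => ∃ m < N, candidate2 N C X m ∧
    (∀ m' < N, ¬ (m' < m ∧ candidate2 N C X m')) ∧ reachN N (implies2 N C) m l) l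

variable (T : ℕ → ℕ → Prop) (n : ℕ)

def edgeSatN (u v : ℕ) : Prop := R u v ∧ sat2 N (clauseN N R T n u v)

/-- The lexicographically first edge with a satisfiable formula. -/
def firstSatN (u v : ℕ) : Prop :=
  edgeSatN N R T n u v ∧
    ∀ u' < N, ∀ v' < N, ¬ ((u' < u ∨ u' = u ∧ v' < v) ∧ edgeSatN N R T n u' v')

def someSatN : Prop := ∃ u < N, ∃ v < N, edgeSatN N R T n u v

def allOneN : Prop := ∀ x < N, ¬ (T 0 x ∧ ¬ T 1 x)

def allZeroN : Prop := ∀ x < N, ¬ (T 0 x ∧ T 1 x)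

/-- The set that is returned. -/
def resultN (x : ℕ) : Prop :=
  (∃ u < N, ∃ v < N, firstSatN N R T n u v ∧ greedy2 N (clauseN N R T n u v) (x + x + 1)) ∨
    -- The answer `∅` needs no case of its own: if both alternatives fail, no number satisfies the
    -- predicate.
    (¬ someSatN N R T n ∧ allOneN N T)

def successN : Prop := someSatN N R T n ∨ allOneN N T ∨ allZeroN N T

end NumberPredicates

/-! ### Definability of the predicates -/

namespace Ctx

variable {α : Type} {Γ : Ctx α}

/-- The context contains the relations `R`, `T` and the number `n`. -/
structure Inputs (Γ : Ctx α) (R T : α → ℕ → ℕ → Prop) (n : α → ℕ) : Prop where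
  rel : Rel Γ R
  tab : Rel Γ T
  num : Tm Γ n

variable {R T : α → ℕ → ℕ → Prop} {n : α → ℕ}

theorem Inputs.v (I : Inputs Γ R T n) :
    Inputs Γ.extV (fun p => R p.1) (fun p => T p.1) (fun p => n p.1) :=
  ⟨I.rel.v, I.tab.v, I.num.v⟩

theorem Inputs.r (I : Inputs Γ R T n) :
    Inputs Γ.extR (fun p => R p.1) (fun p => T p.1) (fun p => n p.1) :=
  ⟨I.rel.r, I.tab.r, I.num.r⟩

variable {u v x y l l' : α → ℕ}

/-- The three extensions hold the set reached so far, the vertex to be tested and its predecessor;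
the predecessor is bound last but is the first argument of `E`. -/
theorem def_reachN {E : α → ℕ → ℕ → Prop}
    (hE : Def Γ.extR.extV.extV fun q => E q.1.1.1 q.2 q.1.2) (hx : Tm Γ x) (hy : Tm Γ y) :
    Def Γ fun a => reachN (Γ.size a) (E a) (x a) (y a) :=
  Def.ifp (F := fun a X j => j = x a ∨ ∃ i < Γ.size a, X i ∧ E a i j)
    (.or (Tm.eq .var hx.r.v) (Def.ex (Γ := Γ.extR.extV)
      (P := fun q i => q.1.2 i ∧ E q.1.1 i q.2) (.and (Sub.app (.v (.v .var)) .var) hE))) hy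

theorem def_triN (I : Inputs Γ R T n) (hu : Tm Γ u) (hv : Tm Γ v) (hx : Tm Γ x) :
    Def Γ fun a => triN (R a) (u a) (v a) (x a) :=
  .and (I.rel.app hu hx) (I.rel.app hv hx)

theorem def_squareN (I : Inputs Γ R T n) (hu : Tm Γ u) (hv : Tm Γ v) (hx : Tm Γ x) :
    Def Γ fun a => squareN (Γ.size a) (R a) (u a) (v a) (x a) :=
  .or (hx.eq hu) <| .or (hx.eq hv) <| .ex <| .ex (Γ := Γ.extV) <|
    .and (I.v.v.rel.app hu.v.v Tm.var.v) <| .and (I.v.v.rel.app Tm.var.v .var) <|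
    .and (I.v.v.rel.app .var hv.v.v) <| .and (Tm.var.v.ne hv.v.v) <| .and (Tm.var.ne hu.v.v) <|
    .or (hx.v.v.eq Tm.var.v) (hx.v.v.eq .var)

theorem def_sideAN (I : Inputs Γ R T n) (hu : Tm Γ u) (hv : Tm Γ v) (hx : Tm Γ x) :
    Def Γ fun a => sideAN (Γ.size a) (R a) (u a) (v a) (x a) :=
  .or (hx.eq hu) <| .and (I.rel.app hu hx) <| .and (I.rel.app hv hx).not <| .and (hx.ne hv) <|
    .ex <| .and (I.v.rel.app hx.v .var) <| .and (I.v.rel.app .var hv.v) (Tm.var.ne hu.v)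

theorem def_farEdge (I : Inputs Γ R T n) (hu : Tm Γ u) (hx : Tm Γ x) (hy : Tm Γ y) :
    Def Γ fun a => farEdge (R a) (u a) (x a) (y a) :=
  .and (I.rel.app hx hy) <| .and (hy.ne hu) (I.rel.app hu hy).not

theorem def_hullN (I : Inputs Γ R T n) (hu : Tm Γ u) (hv : Tm Γ v) (hx : Tm Γ x) :
    Def Γ fun a => hullN (Γ.size a) (R a) (u a) (v a) (x a) := by
  refine Def.ifp (F := fun a X w => sideAN (Γ.size a) (R a) (u a) (v a) w ∨
    ∃ x < Γ.size a, ∃ y < Γ.size a, ∃ z < Γ.size a, X x ∧ X y ∧ x ≠ y ∧ ¬ R a x y ∧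
      R a x w ∧ R a w z ∧ z ≠ x ∧ ¬ R a x z ∧ reachN (Γ.size a) (farEdge (R a) x) z y) ?_ hx
  refine .or (def_sideAN I.r.v hu.r.v hv.r.v .var) ?_
  refine Def.ex (Γ := Γ.extR.extV) <| Def.ex (Γ := Γ.extR.extV.extV) <|
    Def.ex (Γ := Γ.extR.extV.extV.extV) ?_
  have J := I.r.v.v.v.v
  have hw : Tm Γ.extR.extV.extV.extV.extV fun p => p.1.1.1.2 := Tm.var.v.v.v
  have hx : Tm Γ.extR.extV.extV.extV.extV fun p => p.1.1.2 := Tm.var.v.v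
  have hy : Tm Γ.extR.extV.extV.extV.extV fun p => p.1.2 := Tm.var.v
  have hz : Tm Γ.extR.extV.extV.extV.extV fun p => p.2 := Tm.var
  have hX : Sub Γ.extR.extV.extV.extV.extV fun p => p.1.1.1.1.2 := Sub.var.v.v.v.v
  exact .and (hX.app hx) <| .and (hX.app hy) <| .and (hx.ne hy) <| .and (J.rel.app hx hy).not <|
    .and (J.rel.app hx hw) <| .and (J.rel.app hw hz) <| .and (hz.ne hx) <|
    .and (J.rel.app hx hz).not <|
    def_reachN
      (E := fun p : ((((α × (ℕ → Prop)) × ℕ) × ℕ) × ℕ) × ℕ => farEdge (R p.1.1.1.1.1) p.1.1.2)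
      (def_farEdge J.r.v.v hx.r.v.v Tm.var (Tm.v Tm.var)) hz hy

theorem def_cutN (I : Inputs Γ R T n) (hu : Tm Γ u) (hv : Tm Γ v) (hx : Tm Γ x) (hy : Tm Γ y) :
    Def Γ fun a => cutN (Γ.size a) (R a) (u a) (v a) (x a) (y a) :=
  .and (I.rel.app hx hy) <| Def.not <|
    .and (.or (def_squareN I hu hv hx) (def_triN I hu hv hx))
      (.or (def_squareN I hu hv hy) (def_triN I hu hv hy))

theorem Tm.pos (hx : Tm Γ x) : Tm Γ fun a => x a + x a + 1 := (hx.add hx).add (.const 1)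

theorem Tm.neg (hx : Tm Γ x) : Tm Γ fun a => x a + x a := hx.add hx

theorem def_phiTriN (I : Inputs Γ R T n) (hu : Tm Γ u) (hv : Tm Γ v) (hl : Tm Γ l)
    (hl' : Tm Γ l') : Def Γ fun a => phiTriN (Γ.size a) (R a) (u a) (v a) (l a) (l' a) := by
  refine Def.ex <| Def.ex (Γ := Γ.extV) ?_
  have J := I.v.v
  have hx : Tm Γ.extV.extV fun p => p.1.2 := Tm.var.v
  have hy : Tm Γ.extV.extV fun p => p.2 := Tm.var
  exact .and (def_triN J hu.v.v hv.v.v hx) <| .and (def_triN J hu.v.v hv.v.v hy) <|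
    .and (hx.ne hy) <| .and (J.rel.app hx hy).not <|
    .or (.and (hl.v.v.eq hx.pos) (hl'.v.v.eq hy.pos)) (.and (hl.v.v.eq hx.neg) (hl'.v.v.eq hy.neg))

theorem def_phiConvN (I : Inputs Γ R T n) (hu : Tm Γ u) (hv : Tm Γ v) (hl : Tm Γ l)
    (hl' : Tm Γ l') : Def Γ fun a => phiConvN (Γ.size a) (R a) (u a) (v a) (l a) (l' a) := by
  refine Def.ex ?_
  have hx : Tm Γ.extV fun p => p.2 := Tm.var
  exact .or (.and (def_hullN I.v hu.v hv.v hx) <| .and (hl.v.eq hx.pos) (hl'.v.eq hx.pos))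
    (.and (def_hullN I.v hv.v hu.v hx) <| .and (hl.v.eq hx.neg) (hl'.v.eq hx.neg))

theorem def_phiTN (I : Inputs Γ R T n) (hu : Tm Γ u) (hv : Tm Γ v) (hl : Tm Γ l)
    (hl' : Tm Γ l') : Def Γ fun a => phiTN (Γ.size a) (R a) (n a) (u a) (v a) (l a) (l' a) := by
  refine Def.ex <| Def.ex (Γ := Γ.extV) ?_
  have J := I.v.v
  have hx : Tm Γ.extV.extV fun p => p.1.2 := Tm.var.v
  have hy : Tm Γ.extV.extV fun p => p.2 := Tm.var
  exact .and (hx.lt J.num) <|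
    .and (def_reachN
      (E := fun p : (α × ℕ) × ℕ => cutN (Γ.size p.1.1) (R p.1.1) (u p.1.1) (v p.1.1))
      (def_cutN J.r.v.v hu.v.v.r.v.v hv.v.v.r.v.v Tm.var (Tm.v Tm.var)) hx hy) <|
    .or (.and (hl.v.v.eq hx.pos) (hl'.v.v.eq hy.neg)) (.and (hl.v.v.eq hx.neg) (hl'.v.v.eq hy.pos))

theorem def_phi3N (I : Inputs Γ R T n) (b b' : ℕ) (hu : Tm Γ u) (hv : Tm Γ v) (hl : Tm Γ l)
    (hl' : Tm Γ l') :
    Def Γ fun a => phi3N (Γ.size a) (R a) b b' (u a) (v a) (l a) (l' a) := by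
  refine Def.ex <| Def.ex (Γ := Γ.extV) <| Def.ex (Γ := Γ.extV.extV) ?_
  have J := I.v.v.v
  have hx : Tm Γ.extV.extV.extV fun p => p.1.1.2 := Tm.var.v.v
  have hy : Tm Γ.extV.extV.extV fun p => p.1.2 := Tm.var.v
  have hz : Tm Γ.extV.extV.extV fun p => p.2 := Tm.var
  exact .and (def_sideAN J hu.v.v.v hv.v.v.v hx) <| .and (def_triN J hu.v.v.v hv.v.v.v hz) <|
    .and (J.rel.app hx hy) <| .and (J.rel.app hy hz) <| .and (hx.ne hz) <|
    .and (J.rel.app hx hz).not <|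
    .and (hl.v.v.v.eq (hy.neg.add (.const b))) (hl'.v.v.v.eq (hz.neg.add (.const b')))

theorem def_phi4N (I : Inputs Γ R T n) (b b' : ℕ) (hu : Tm Γ u) (hv : Tm Γ v) (hl : Tm Γ l)
    (hl' : Tm Γ l') :
    Def Γ fun a => phi4N (Γ.size a) (R a) b b' (u a) (v a) (l a) (l' a) := by
  refine Def.ex <| Def.ex (Γ := Γ.extV) <| Def.ex (Γ := Γ.extV.extV) <|
    Def.ex (Γ := Γ.extV.extV.extV) ?_
  have J := I.v.v.v.v
  have hx : Tm Γ.extV.extV.extV.extV fun p => p.1.1.1.2 := Tm.var.v.v.v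
  have hw : Tm Γ.extV.extV.extV.extV fun p => p.1.1.2 := Tm.var.v.v
  have hy : Tm Γ.extV.extV.extV.extV fun p => p.1.2 := Tm.var.v
  have hz : Tm Γ.extV.extV.extV.extV fun p => p.2 := Tm.var
  exact .and (def_sideAN J hu.v.v.v.v hv.v.v.v.v hx) <|
    .and (def_triN J hu.v.v.v.v hv.v.v.v.v hz) <|
    .and (J.rel.app hx hw) <| .and (J.rel.app hw hy) <| .and (J.rel.app hy hz) <|
    .and (hx.ne hy) <| .and (hx.ne hz) <| .and (hw.ne hz) <| .and (J.rel.app hx hy).not <|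
    .and (J.rel.app hx hz).not <| .and (J.rel.app hw hz).not <|
    .and (hl.v.v.v.v.eq (hy.neg.add (.const b))) (hl'.v.v.v.v.eq (hz.neg.add (.const b')))

theorem def_phiAN (I : Inputs Γ R T n) (b b' : ℕ) (hu : Tm Γ u) (hv : Tm Γ v) (hl : Tm Γ l)
    (hl' : Tm Γ l') :
    Def Γ fun a => phiAN (Γ.size a) (R a) b b' (u a) (v a) (l a) (l' a) := by
  refine Def.ex <| Def.ex (Γ := Γ.extV) <| Def.ex (Γ := Γ.extV.extV) ?_
  have J := I.v.v.v
  have hx : Tm Γ.extV.extV.extV fun p => p.1.1.2 := Tm.var.v.v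
  have hy : Tm Γ.extV.extV.extV fun p => p.1.2 := Tm.var.v
  have hz : Tm Γ.extV.extV.extV fun p => p.2 := Tm.var
  exact .and (J.rel.app hx hy) <| .and (def_hullN J hu.v.v.v hv.v.v.v hx) <|
    .and (def_triN J hu.v.v.v hv.v.v.v hz) <| .and (hz.ne hx) <|
    .and (J.rel.app hx hz).not <|
    .and (hl.v.v.v.eq (hy.neg.add (.const b))) (hl'.v.v.v.eq (hz.neg.add (.const b')))

theorem def_phiN (I : Inputs Γ R T n) (hu : Tm Γ u) (hv : Tm Γ v) (hl : Tm Γ l)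
    (hl' : Tm Γ l') : Def Γ fun a => phiN (Γ.size a) (R a) (n a) (u a) (v a) (l a) (l' a) :=
  .or (def_phiTriN I hu hv hl hl') <| .or (def_phiConvN I hu hv hl hl') <|
    .or (def_phiTN I hu hv hl hl') <|
    .or (def_phi3N I 1 0 hu hv hl hl') <| .or (def_phi3N I 0 1 hv hu hl hl') <|
    .or (def_phi4N I 1 0 hu hv hl hl') <| .or (def_phi4N I 0 1 hv hu hl hl') <|
    .or (def_phiAN I 1 0 hu hv hl hl') (def_phiAN I 0 1 hv hu hl hl')

theorem def_clauseN (I : Inputs Γ R T n) (hu : Tm Γ u) (hv : Tm Γ v) (hl : Tm Γ l)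
    (hl' : Tm Γ l') :
    Def Γ fun a => clauseN (Γ.size a) (R a) (T a) (n a) (u a) (v a) (l a) (l' a) := by
  refine .or (def_phiN I hu hv hl hl') (Def.ex ?_)
  have hx : Tm Γ.extV fun p => p.2 := Tm.var
  exact .and (I.v.tab.app (.const 0) hx) <|
    .or (.and (I.v.tab.app (.const 1) hx) <| .and (hl.v.eq hx.pos) (hl'.v.eq hx.pos))
      (.and (I.v.tab.app (.const 1) hx).not <| .and (hl.v.eq hx.neg) (hl'.v.eq hx.neg))

theorem def_compl2 (hl : Tm Γ l) (hl' : Tm Γ l') :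
    Def Γ fun a => compl2 (Γ.size a) (l a) (l' a) := by
  refine Def.ex ?_
  have hx : Tm Γ.extV fun p => p.2 := Tm.var
  exact .or (.and (hl.v.eq hx.neg) (hl'.v.eq hx.pos)) (.and (hl.v.eq hx.pos) (hl'.v.eq hx.neg))

theorem def_implies2 (I : Inputs Γ R T n) (hu : Tm Γ u) (hv : Tm Γ v) (hl : Tm Γ l)
    (hl' : Tm Γ l') :
    Def Γ fun a => implies2 (Γ.size a) (clauseN (Γ.size a) (R a) (T a) (n a) (u a) (v a))
      (l a) (l' a) := by
  refine Def.ex ?_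
  have hx : Tm Γ.extV fun p => p.2 := Tm.var
  exact .and (def_compl2 hl.v hx) (.or (def_clauseN I.v hu.v hv.v hx hl'.v)
    (def_clauseN I.v hu.v hv.v hl'.v hx))

theorem def_reach2 (I : Inputs Γ R T n) (hu : Tm Γ u) (hv : Tm Γ v) (hl : Tm Γ l)
    (hl' : Tm Γ l') :
    Def Γ fun a => reachN (Γ.size a)
      (implies2 (Γ.size a) (clauseN (Γ.size a) (R a) (T a) (n a) (u a) (v a))) (l a) (l' a) :=
  def_reachN (E := fun a => implies2 (Γ.size a)
      (clauseN (Γ.size a) (R a) (T a) (n a) (u a) (v a)))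
    (def_implies2 I.r.v.v hu.r.v.v hv.r.v.v Tm.var (Tm.v Tm.var)) hl hl'

theorem def_sat2 (I : Inputs Γ R T n) (hu : Tm Γ u) (hv : Tm Γ v) :
    Def Γ fun a => sat2 (Γ.size a) (clauseN (Γ.size a) (R a) (T a) (n a) (u a) (v a)) := by
  refine Def.all <| Def.all (Γ := Γ.extV) ?_
  have hx : Tm Γ.extV.extV fun p => p.1.2 := Tm.var.v
  have hy : Tm Γ.extV.extV fun p => p.2 := Tm.var
  exact Def.not <| .and (def_compl2 hx hy) <|
    .and (def_reach2 I.v.v hu.v.v hv.v.v hx hy) (def_reach2 I.v.v hu.v.v hv.v.v hy hx)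

theorem def_candidate2 (I : Inputs Γ R T n) (hu : Tm Γ u) (hv : Tm Γ v) {X : α → ℕ → Prop}
    (hX : Sub Γ X) (hl : Tm Γ l) :
    Def Γ fun a => candidate2 (Γ.size a) (clauseN (Γ.size a) (R a) (T a) (n a) (u a) (v a))
      (X a) (l a) := by
  refine Def.ex ?_
  have hx : Tm Γ.extV fun p => p.2 := Tm.var
  exact .and (def_compl2 hl.v hx) <| .and (hX.v.app hl.v).not <| .and (hX.v.app hx).not
    (def_reach2 I.v hu.v hv.v hl.v hx).not

theorem def_greedy2 (I : Inputs Γ R T n) (hu : Tm Γ u) (hv : Tm Γ v) (hl : Tm Γ l) :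
    Def Γ fun a => greedy2 (Γ.size a) (clauseN (Γ.size a) (R a) (T a) (n a) (u a) (v a))
      (l a) := by
  refine Def.ifp (F := fun a X l => ∃ m < Γ.size a,
    candidate2 (Γ.size a) (clauseN (Γ.size a) (R a) (T a) (n a) (u a) (v a)) X m ∧
    (∀ m' < Γ.size a, ¬ (m' < m ∧
      candidate2 (Γ.size a) (clauseN (Γ.size a) (R a) (T a) (n a) (u a) (v a)) X m')) ∧
    reachN (Γ.size a) (implies2 (Γ.size a)
      (clauseN (Γ.size a) (R a) (T a) (n a) (u a) (v a))) m l) ?_ hl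
  refine Def.ex (Γ := Γ.extR.extV) ?_
  have hm : Tm Γ.extR.extV.extV fun p => p.2 := Tm.var
  have hl : Tm Γ.extR.extV.extV fun p => p.1.2 := Tm.var.v
  have hX : Sub Γ.extR.extV.extV fun p => p.1.1.2 := Sub.var.v.v
  refine .and (def_candidate2 I.r.v.v hu.r.v.v hv.r.v.v hX hm) <|
    .and (Def.all (Γ := Γ.extR.extV.extV) ?_) (def_reach2 I.r.v.v hu.r.v.v hv.r.v.v hm hl)
  exact Def.not <| .and (Tm.var.lt hm.v)
    (def_candidate2 I.r.v.v.v hu.r.v.v.v hv.r.v.v.v hX.v Tm.var)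

theorem def_edgeSatN (I : Inputs Γ R T n) (hu : Tm Γ u) (hv : Tm Γ v) :
    Def Γ fun a => edgeSatN (Γ.size a) (R a) (T a) (n a) (u a) (v a) :=
  .and (I.rel.app hu hv) (def_sat2 I hu hv)

theorem def_firstSatN (I : Inputs Γ R T n) (hu : Tm Γ u) (hv : Tm Γ v) :
    Def Γ fun a => firstSatN (Γ.size a) (R a) (T a) (n a) (u a) (v a) := by
  refine .and (def_edgeSatN I hu hv) <| Def.all <| Def.all (Γ := Γ.extV) ?_
  have hx : Tm Γ.extV.extV fun p => p.1.2 := Tm.var.v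
  have hy : Tm Γ.extV.extV fun p => p.2 := Tm.var
  exact Def.not <| .and (.or (hx.lt hu.v.v) (.and (hx.eq hu.v.v) (hy.lt hv.v.v)))
    (def_edgeSatN I.v.v hx hy)

theorem def_someSatN (I : Inputs Γ R T n) :
    Def Γ fun a => someSatN (Γ.size a) (R a) (T a) (n a) :=
  Def.ex <| Def.ex (Γ := Γ.extV) <| def_edgeSatN I.v.v Tm.var.v Tm.var

theorem def_allOneN (I : Inputs Γ R T n) : Def Γ fun a => allOneN (Γ.size a) (T a) :=
  Def.all <| Def.not <| .and (I.v.tab.app (.const 0) .var) (I.v.tab.app (.const 1) .var).not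

theorem def_allZeroN (I : Inputs Γ R T n) : Def Γ fun a => allZeroN (Γ.size a) (T a) :=
  Def.all <| Def.not <| .and (I.v.tab.app (.const 0) .var) (I.v.tab.app (.const 1) .var)

theorem def_resultN (I : Inputs Γ R T n) (hx : Tm Γ x) :
    Def Γ fun a => resultN (Γ.size a) (R a) (T a) (n a) (x a) := by
  refine .or (Def.ex <| Def.ex (Γ := Γ.extV) ?_) (.and (def_someSatN I).not (def_allOneN I))
  have hu : Tm Γ.extV.extV fun p => p.1.2 := Tm.var.v
  have hv : Tm Γ.extV.extV fun p => p.2 := Tm.var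
  exact .and (def_firstSatN I.v.v hu hv) (def_greedy2 I.v.v hu hv hx.v.v.pos)

theorem def_successN (I : Inputs Γ R T n) :
    Def Γ fun a => successN (Γ.size a) (R a) (T a) (n a) :=
  .or (def_someSatN I) <| .or (def_allOneN I) (def_allZeroN I)

end Ctx

/-! ### Reachability -/

/-- The stages contain only reachable numbers, and the fixed point is closed under `E`. The bound on
the targets of `E` keeps whole paths inside the range of the fixed point. -/
theorem reachN_iff {N : ℕ} {E : ℕ → ℕ → Prop} (hE : ∀ i j, E i j → j < N) {a b : ℕ} :
    reachN N E a b ↔ a < N ∧ Relation.ReflTransGen E a b := by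
  constructor
  · refine fun h => ifp_induction
      (Q := fun X => ∀ i, X i → a < N ∧ Relation.ReflTransGen E a i) (fun i hi => hi.elim) ?_ b h
    rintro X - hX i ⟨hi, h | rfl | ⟨z, -, hz, hzi⟩⟩
    · exact hX i h
    · exact ⟨hi, .refl⟩
    · exact ⟨(hX z hz).1, (hX z hz).2.tail hzi⟩
  · rintro ⟨ha, h⟩
    induction h with
    | refl => exact ifp_closed ha (.inl rfl)
    | tail h1 h2 ih => exact ifp_closed (hE _ _ h2) (.inr ⟨_, ifp_lt ih, ih, h2⟩)

/-! ### Satisfiability of 2-CNF formulas -/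

section TwoSat

/-- The complementary literal. -/
def flip2 (l : ℕ) : ℕ := if l % 2 = 0 then l + 1 else l - 1

theorem flip2_flip2 (l : ℕ) : flip2 (flip2 l) = l := by
  unfold flip2; split_ifs <;> omega

theorem flip2_lt {n l : ℕ} (h : l < n + n) : flip2 l < n + n := by
  unfold flip2; split_ifs <;> omega

theorem compl2_iff {N l l' : ℕ} (h : l < N) : compl2 N l l' ↔ l' = flip2 l := by
  unfold compl2 flip2
  constructor
  · rintro ⟨x, hx, ⟨rfl, rfl⟩ | ⟨rfl, rfl⟩⟩
    · rw [if_pos (by omega)]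
    · rw [if_neg (by omega)]; omega
  · intro h'
    refine ⟨l / 2, by omega, ?_⟩
    split_ifs at h' <;> omega

variable {n : ℕ} {C : ℕ → ℕ → Prop} (hC : ∀ l l', C l l' → l < n + n ∧ l' < n + n)
include hC

omit hC in
theorem implies2_iff {l m : ℕ} :
    implies2 (n + n) C l m ↔ l < n + n ∧ (C (flip2 l) m ∨ C m (flip2 l)) := by
  constructor
  · rintro ⟨l', hl', h1, h2⟩
    have hl : l < n + n := by
      obtain ⟨x, hx, h | h⟩ := h1 <;> omega
    rw [compl2_iff hl] at h1
    exact ⟨hl, h1 ▸ h2⟩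
  · rintro ⟨hl, h⟩
    exact ⟨flip2 l, flip2_lt hl, (compl2_iff hl).2 rfl, h⟩

theorem implies2_lt {l m : ℕ} (h : implies2 (n + n) C l m) : m < n + n := by
  rcases ((implies2_iff).1 h).2 with h | h
  · exact (hC _ _ h).2
  · exact (hC _ _ h).1

/-- A clause is symmetric, so it yields an implication together with its contrapositive. -/
theorem implies2_contra {l m : ℕ} (h : implies2 (n + n) C l m) :
    implies2 (n + n) C (flip2 m) (flip2 l) := by
  have hm := implies2_lt hC h
  rw [implies2_iff] at h ⊢
  refine ⟨flip2_lt hm, ?_⟩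
  rw [flip2_flip2]
  exact h.2.symm

theorem reflTransGen_contra {l m : ℕ} (h : Relation.ReflTransGen (implies2 (n + n) C) l m) :
    Relation.ReflTransGen (implies2 (n + n) C) (flip2 m) (flip2 l) := by
  induction h with
  | refl => exact .refl
  | tail _ h2 ih => exact .head (implies2_contra hC h2) ih

theorem candidate2_iff {X : ℕ → Prop} {m : ℕ} (hm : m < n + n) :
    candidate2 (n + n) C X m ↔
      ¬ X m ∧ ¬ X (flip2 m) ∧ ¬ Relation.ReflTransGen (implies2 (n + n) C) m (flip2 m) := by
  unfold candidate2
  constructor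
  · rintro ⟨m', -, h1, h2, h3, h4⟩
    rw [compl2_iff hm] at h1
    subst h1
    rw [reachN_iff fun _ _ => implies2_lt hC] at h4
    exact ⟨h2, h3, fun h => h4 ⟨hm, h⟩⟩
  · rintro ⟨h2, h3, h4⟩
    refine ⟨flip2 m, flip2_lt hm, (compl2_iff hm).2 rfl, h2, h3, ?_⟩
    rw [reachN_iff fun _ _ => implies2_lt hC]
    exact fun h => h4 h.2

/-- The greedy solution is closed under implication and consistent. -/
theorem greedy2_closed :
    (∀ l m, greedy2 (n + n) C l → implies2 (n + n) C l m → greedy2 (n + n) C m) ∧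
      ∀ l, ¬ (greedy2 (n + n) C l ∧ greedy2 (n + n) C (flip2 l)) := by
  refine ifp_induction (Q := fun X => (∀ l m, X l → implies2 (n + n) C l m → X m) ∧
    ∀ l, ¬ (X l ∧ X (flip2 l))) ⟨fun _ _ h => h.elim, fun _ h => h.1⟩ ?_
  rintro X - ⟨hcl, hco⟩
  have hcl' : ∀ l m, X l → Relation.ReflTransGen (implies2 (n + n) C) l m → X m := by
    intro l m hl h
    induction h with
    | refl => exact hl
    | tail _ h2 ih => exact hcl _ _ ih h2
  refine ⟨?_, ?_⟩
  · rintro l m ⟨hl, h | ⟨k, hk, h1, h2, h3⟩⟩ hlm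
    · exact ⟨implies2_lt hC hlm, .inl (hcl l m h hlm)⟩
    · refine ⟨implies2_lt hC hlm, .inr ⟨k, hk, h1, h2, ?_⟩⟩
      rw [reachN_iff fun _ _ => implies2_lt hC] at h3 ⊢
      exact ⟨hk, h3.2.tail hlm⟩
  · rintro l ⟨⟨hl, h⟩, ⟨hl', h'⟩⟩
    -- If the new literal `k` implied the complement of an old `l`, then by contraposition `l` would
    -- imply the complement of `k`. That complement would lie in the closed set `X`, and `k` would
    -- not be a candidate.
    have mixed : ∀ l, X l → ∀ k < n + n, candidate2 (n + n) C X k →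
        ¬ reachN (n + n) (implies2 (n + n) C) k (flip2 l) := by
      intro l hl k hk h1 h3
      rw [reachN_iff fun _ _ => implies2_lt hC] at h3
      have := reflTransGen_contra hC h3.2
      rw [flip2_flip2] at this
      exact ((candidate2_iff hC hk).1 h1).2.1 (hcl' _ _ hl this)
    rcases h with h | ⟨k, hk, h1, h2, h3⟩ <;> rcases h' with h' | ⟨k', hk', h1', h2', h3'⟩
    · exact hco l ⟨h, h'⟩
    · exact mixed l h k' hk' h1' h3'
    · refine mixed _ h' k hk h1 ?_
      rwa [flip2_flip2]
    -- A round has only one least candidate `k`. If it implied both `l` and its complement,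
    -- contraposition would lead from `k` through `l` to the complement of `k`.
    · have hkk : k = k' := by
        rcases lt_trichotomy k k' with h | h | h
        · exact absurd ⟨h, h1⟩ (h2' k hk)
        · exact h
        · exact absurd ⟨h, h1'⟩ (h2 k' hk')
      subst hkk
      rw [reachN_iff fun _ _ => implies2_lt hC] at h3 h3'
      have := reflTransGen_contra hC h3'.2
      rw [flip2_flip2] at this
      exact ((candidate2_iff hC hk).1 h1).2.2 (h3.2.trans this)

/-- The greedy solution decides every variable. -/
theorem greedy2_total (hs : sat2 (n + n) C) {l : ℕ} (hl : l < n + n) :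
    greedy2 (n + n) C l ∨ greedy2 (n + n) C (flip2 l) := by
  classical
  by_contra hcon
  push Not at hcon
  -- An undecided variable leaves a candidate: by `hs`, one of its two literals does not imply the
  -- other.
  have hex : ∃ m, m < n + n ∧ candidate2 (n + n) C (greedy2 (n + n) C) m := by
    by_cases hr : Relation.ReflTransGen (implies2 (n + n) C) l (flip2 l)
    · refine ⟨flip2 l, flip2_lt hl, (candidate2_iff hC (flip2_lt hl)).2
        ⟨hcon.2, by rw [flip2_flip2]; exact hcon.1, fun hr' => ?_⟩⟩
      rw [flip2_flip2] at hr'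
      refine hs l hl _ (flip2_lt hl) ⟨(compl2_iff hl).2 rfl, ?_, ?_⟩
      · exact (reachN_iff fun _ _ => implies2_lt hC).2 ⟨hl, hr⟩
      · exact (reachN_iff fun _ _ => implies2_lt hC).2 ⟨flip2_lt hl, hr'⟩
    · exact ⟨l, hl, (candidate2_iff hC hl).2 ⟨hcon.1, hcon.2, hr⟩⟩
  -- One more round would add the least candidate, but the fixed point is closed, so it is already
  -- decided.
  obtain ⟨hm, hc⟩ := Nat.find_spec hex
  have : greedy2 (n + n) C (Nat.find hex) := by
    refine ifp_closed hm ⟨_, hm, hc, ?_, (reachN_iff fun _ _ => implies2_lt hC).2 ⟨hm, .refl⟩⟩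
    rintro m' hm' ⟨h1, h2⟩
    exact Nat.find_min hex h1 ⟨hm', h2⟩
  exact ((candidate2_iff hC hm).1 hc).1 this

theorem greedy2_flip2 (hs : sat2 (n + n) C) {l : ℕ} (hl : l < n + n) :
    greedy2 (n + n) C (flip2 l) ↔ ¬ greedy2 (n + n) C l := by
  have h1 := greedy2_total hC hs hl
  have h2 := (greedy2_closed hC).2 l
  tauto

theorem greedy2_clause (hs : sat2 (n + n) C) {l l' : ℕ} (h : C l l') :
    greedy2 (n + n) C l ∨ greedy2 (n + n) C l' := by
  by_contra hcon
  push Not at hcon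
  obtain ⟨hl, hl'⟩ := hC _ _ h
  have := (greedy2_flip2 hC hs hl).2 hcon.1
  refine hcon.2 ((greedy2_closed hC).1 _ _ this ((implies2_iff).2 ⟨flip2_lt hl, ?_⟩))
  rw [flip2_flip2]
  exact .inl h

/-- Truth propagates along implications, so equivalent literals have equal values and cannot be
complementary. -/
theorem sat2_of_valuation (val : ℕ → Prop) (hv : ∀ l < n + n, val (flip2 l) ↔ ¬ val l)
    (h : ∀ l l', C l l' → val l ∨ val l') : sat2 (n + n) C := by
  rintro l hl l' hl' ⟨h1, h2, h3⟩
  rw [compl2_iff hl] at h1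
  subst h1
  have mono : ∀ l m, Relation.ReflTransGen (implies2 (n + n) C) l m → val l → val m := by
    intro l m hr hl
    induction hr with
    | refl => exact hl
    | tail _ h2 ih =>
      obtain ⟨h3, h4⟩ := (implies2_iff).1 h2
      have := hv _ h3
      rcases h4 with h4 | h4
      · have := h _ _ h4; tauto
      · have := h _ _ h4; tauto
  rw [reachN_iff fun _ _ => implies2_lt hC] at h2 h3
  have h4 := mono _ _ h2.2
  have h5 := mono _ _ h3.2
  have := hv l hl
  tauto

end TwoSat

/-! ### The number predicates of a graph -/

section Link

variable {n : ℕ} (G : SimpleGraph (Fin n))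

/-- Adjacency of numbered vertices. -/
def natAdj (i j : ℕ) : Prop := ∃ a b : Fin n, (a : ℕ) = i ∧ (b : ℕ) = j ∧ G.Adj a b

variable {G}

@[simp]
theorem natAdj_val {a b : Fin n} : natAdj G a b ↔ G.Adj a b := by
  constructor
  · rintro ⟨a', b', h1, h2, h⟩
    rwa [Fin.ext h1, Fin.ext h2] at h
  · exact fun h => ⟨a, b, rfl, rfl, h⟩

theorem natAdj_lt {i j : ℕ} (h : natAdj G i j) : i < n ∧ j < n := by
  obtain ⟨a, b, rfl, rfl, -⟩ := h
  exact ⟨a.2, b.2⟩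

theorem exists_lt_iff_fin {N : ℕ} (hN : n ≤ N) {P : ℕ → Prop} (hP : ∀ i, P i → i < n) :
    (∃ i < N, P i) ↔ ∃ x : Fin n, P x :=
  ⟨fun ⟨i, _, h⟩ => ⟨⟨i, hP i h⟩, h⟩, fun ⟨x, h⟩ => ⟨x, by omega, h⟩⟩

variable {N : ℕ} (hN : n ≤ N) {u v : Fin n}

theorem triN_lt {i j k : ℕ} (h : triN (natAdj G) i j k) : k < n := (natAdj_lt h.1).2

@[simp]
theorem triN_iff {x : Fin n} : triN (natAdj G) u v x ↔ x ∈ tri G u v := by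
  simp [triN, tri]

include hN

theorem squareN_iff {x : Fin n} : squareN N (natAdj G) u v x ↔ x ∈ square G u v := by
  constructor
  · rintro (h | h | ⟨a, -, b, -, h1, h2, h3, h4, h5, h6⟩)
    · exact .inl (Fin.ext h)
    · exact .inr (.inl (Fin.ext h))
    · obtain ⟨a, b, rfl, rfl, h2⟩ := h2
      rw [natAdj_val] at h1 h3
      rw [← Fin.ext_iff, ← Fin.ext_iff] at h6
      exact .inr (.inr ⟨a, b, h1, h2, h3, fun h => h4 (congrArg _ h), fun h => h5 (congrArg _ h),
        h6⟩)
  · rintro (rfl | rfl | ⟨a, b, h1, h2, h3, h4, h5, h6⟩)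
    · exact .inl rfl
    · exact .inr (.inl rfl)
    · refine .inr (.inr ⟨a, by omega, b, by omega, natAdj_val.2 h1, natAdj_val.2 h2,
        natAdj_val.2 h3, fun h => h4 (Fin.ext h), fun h => h5 (Fin.ext h), ?_⟩)
      rwa [← Fin.ext_iff, ← Fin.ext_iff]

theorem sideAN_iff (hG : G.Connected) (huv : G.Adj u v) {x : Fin n} :
    sideAN N (natAdj G) u v x ↔ x ∈ sideA G u v := by
  rw [mem_sideA_iff hG huv]
  unfold sideAN
  rw [exists_lt_iff_fin hN (by rintro i ⟨h, -⟩; exact (natAdj_lt h).2)]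
  simp [Fin.ext_iff]

omit hN in
theorem sideAN_lt {i : ℕ} (h : sideAN N (natAdj G) u v i) : i < n := by
  rcases h with rfl | ⟨h, -⟩
  · exact u.2
  · exact (natAdj_lt h).2

theorem reachN_cutN_iff {x y : Fin n} :
    reachN N (cutN N (natAdj G) u v) x y ↔ (cutGraph G u v).Reachable x y := by
  have hadj : ∀ a b : Fin n, cutN N (natAdj G) u v a b ↔ (cutGraph G u v).Adj a b := by
    intro a b
    simp only [cutN, natAdj_val, squareN_iff hN, triN_iff, cutGraph, SimpleGraph.deleteEdges_adj]
    simp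
  rw [reachN_iff fun i j h => (natAdj_lt h.1).2.trans_le hN,
    SimpleGraph.reachable_iff_reflTransGen]
  constructor
  · rintro ⟨-, h⟩
    have key : ∀ j, Relation.ReflTransGen (cutN N (natAdj G) u v) x j → ∃ y : Fin n, (y : ℕ) = j ∧
        Relation.ReflTransGen (cutGraph G u v).Adj x y := by
      intro j h
      induction h with
      | refl => exact ⟨x, rfl, .refl⟩
      | @tail b c _ h2 ih =>
        obtain ⟨y, rfl, hy⟩ := ih
        obtain ⟨c, rfl⟩ : ∃ c' : Fin n, (c' : ℕ) = c := ⟨⟨c, (natAdj_lt h2.1).2⟩, rfl⟩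
        exact ⟨c, rfl, hy.tail ((hadj _ _).1 h2)⟩
    obtain ⟨y', hy', h'⟩ := key y h
    rwa [Fin.ext hy'] at h'
  · exact fun h => ⟨by omega, h.lift (fun a : Fin n => (a : ℕ)) fun a b hab => (hadj a b).2 hab⟩

omit hN in
theorem exists_walk_of_farEdge {x z y : Fin n} (hz : z ≠ x ∧ ¬ G.Adj x z)
    (h : Relation.ReflTransGen (farEdge (natAdj G) x) z y) :
    ∃ p : G.Walk z y, ∀ a ∈ p.support, a ≠ x ∧ ¬ G.Adj x a := by
  have key : ∀ j, Relation.ReflTransGen (farEdge (natAdj G) x) z j → ∃ y : Fin n, (y : ℕ) = j ∧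
      ∃ p : G.Walk z y, ∀ a ∈ p.support, a ≠ x ∧ ¬ G.Adj x a := by
    intro j h
    induction h with
    | refl => exact ⟨z, rfl, .nil, by simpa using hz⟩
    | @tail b c _ h2 ih =>
      obtain ⟨y, rfl, p, hp⟩ := ih
      obtain ⟨c, rfl⟩ : ∃ c' : Fin n, (c' : ℕ) = c := ⟨⟨c, (natAdj_lt h2.1).2⟩, rfl⟩
      obtain ⟨h3, h4, h5⟩ := h2
      rw [natAdj_val] at h3 h5
      refine ⟨c, rfl, p.concat h3, fun a ha => ?_⟩
      rw [SimpleGraph.Walk.support_concat] at ha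
      simp only [List.mem_append, List.mem_singleton] at ha
      rcases ha with ha | rfl
      · exact hp a ha
      · exact ⟨fun h => h4 (congrArg _ h), h5⟩
  obtain ⟨y', hy', h'⟩ := key y h
  obtain rfl := Fin.ext hy'
  exact h'

omit hN in
theorem farEdge_of_walk {x z y : Fin n} (p : G.Walk z y)
    (hp : ∀ a ∈ p.support, a ≠ x ∧ ¬ G.Adj x a) :
    Relation.ReflTransGen (farEdge (natAdj G) x) z y := by
  induction p with
  | nil => exact .refl
  | @cons z w y h p ih =>
    have hw := hp w (by simp)
    refine .head ⟨natAdj_val.2 h, fun h => hw.1 (Fin.ext h), by rw [natAdj_val]; exact hw.2⟩ ?_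
    exact ih fun a ha => hp a (by simp [ha])

theorem reachN_farEdge_iff {x z y : Fin n} (hz : z ≠ x ∧ ¬ G.Adj x z) :
    reachN N (farEdge (natAdj G) x) z y ↔
      ∃ p : G.Walk z y, ∀ a ∈ p.support, a ≠ x ∧ ¬ G.Adj x a := by
  rw [reachN_iff fun i j h => (natAdj_lt h.1).2.trans_le hN]
  exact ⟨fun h => exists_walk_of_farEdge hz h.2,
    fun ⟨p, hp⟩ => ⟨by omega, farEdge_of_walk p hp⟩⟩

theorem exists_mem_mHull_of_hullN (hG : G.Connected) (huv : G.Adj u v) :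
    ∀ i, hullN N (natAdj G) u v i → ∃ w : Fin n, (w : ℕ) = i ∧ w ∈ mHull G (sideA G u v) := by
  refine ifp_induction
    (Q := fun X => ∀ i, X i → ∃ w : Fin n, (w : ℕ) = i ∧ w ∈ mHull G (sideA G u v))
    (fun _ h => h.elim) ?_
  rintro X - hX i ⟨-, h | h | ⟨x, -, y, -, z, -, hx, hy, hxy, hnxy, hxw, hwz, hzx, hnxz, hr⟩⟩
  · exact hX i h
  · refine ⟨⟨i, sideAN_lt h⟩, rfl, subset_mHull _ ((sideAN_iff hN hG huv).1 h)⟩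
  · obtain ⟨x, rfl, hxm⟩ := hX x hx
    obtain ⟨y, rfl, hym⟩ := hX y hy
    obtain ⟨w, z, rfl, rfl, hwz⟩ := hwz
    rw [natAdj_val] at hnxy hxw hnxz
    have hzx' : z ≠ x := fun h => hzx (congrArg _ h)
    obtain ⟨p, hp⟩ := (reachN_farEdge_iff hN ⟨hzx', hnxz⟩).1 hr
    exact ⟨w, rfl, isMConvex_mHull _ x hxm y hym
      (mem_interval_of_walk (fun h => hxy (congrArg _ h)) hxw hwz p hp)⟩

/-- Each stage adds only second vertices of induced paths between members of the hull. Conversely,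
the fixed point contains `A^u` and is convex by `isMConvex_of_forall_walk`, so it contains the hull.
-/
theorem hullN_iff (hG : G.Connected) (huv : G.Adj u v) {w : Fin n} :
    hullN N (natAdj G) u v w ↔ w ∈ mHull G (sideA G u v) := by
  constructor
  · intro h
    obtain ⟨w', h1, h2⟩ := exists_mem_mHull_of_hullN hN hG huv w h
    rwa [Fin.ext h1] at h2
  · have : mHull G (sideA G u v) ⊆ {w : Fin n | hullN N (natAdj G) u v w} := by
      refine mHull_subset (isMConvex_of_forall_walk ?_) ?_
      · intro x hx y hy w z hxy hnxy hxw hwz hp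
        obtain ⟨p, hp⟩ := hp
        have hz := hp z p.start_mem_support
        exact ifp_closed (w.2.trans_le hN) (.inr ⟨x, x.2.trans_le hN, y, y.2.trans_le hN, z,
          z.2.trans_le hN, hx, hy, fun h => hxy (Fin.ext h), by rwa [natAdj_val], by
          rwa [natAdj_val], by rwa [natAdj_val], fun h => hz.1 (Fin.ext h), by
          rw [natAdj_val]; exact hz.2, (reachN_farEdge_iff hN hz).2 ⟨p, hp⟩⟩)
      · intro w hw
        exact ifp_closed (w.2.trans_le hN) (.inl ((sideAN_iff hN hG huv).2 hw))
    exact fun h => this h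

end Link

/-! ### Numbered clauses -/

section Codes

variable {n : ℕ}

/-- The formula `φ` has a clause with the literal numbers `l` and `l'`. -/
def HasCode (φ : TwoCNF (Fin n)) (l l' : ℕ) : Prop :=
  ∃ c ∈ φ, litCode c.1 = l ∧ litCode c.2 = l'

theorem litCode_eq (x : Fin n) (b : Bool) : litCode (x, b) = x + x + b.toNat := by
  cases b <;> simp [litCode] <;> omega

theorem litCode_injective : Function.Injective (litCode : Lit (Fin n) → ℕ) := by
  rintro ⟨x, b⟩ ⟨y, c⟩ h
  rw [litCode_eq, litCode_eq] at h
  cases b <;> cases c <;> simp at h ⊢ <;> omega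

theorem litCode_lt (l : Lit (Fin n)) : litCode l < n + n := by
  obtain ⟨x, b⟩ := l
  rw [litCode_eq]
  have := x.2
  cases b <;> simp <;> omega

theorem exists_litCode_eq {l : ℕ} (h : l < n + n) : ∃ k : Lit (Fin n), litCode k = l := by
  refine ⟨(⟨l / 2, by omega⟩, decide (l % 2 = 1)), ?_⟩
  rw [litCode_eq]
  rcases Nat.mod_two_eq_zero_or_one l with h | h <;> simp [h] <;> omega

theorem flip2_litCode (x : Fin n) (b : Bool) : flip2 (litCode (x, b)) = litCode (x, !b) := by
  rw [litCode_eq, litCode_eq]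
  unfold flip2
  cases b
  · simp; omega
  · simp; omega

theorem HasCode.lt {φ : TwoCNF (Fin n)} {l l' : ℕ} (h : HasCode φ l l') :
    l < n + n ∧ l' < n + n := by
  obtain ⟨c, -, rfl, rfl⟩ := h
  exact ⟨litCode_lt _, litCode_lt _⟩

theorem hasCode_litCode {φ : TwoCNF (Fin n)} {c : Lit (Fin n) × Lit (Fin n)} :
    HasCode φ (litCode c.1) (litCode c.2) ↔ c ∈ φ := by
  constructor
  · rintro ⟨d, hd, h1, h2⟩
    have : d = c := Prod.ext (litCode_injective h1) (litCode_injective h2)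
    exact this ▸ hd
  · exact fun h => ⟨c, h, rfl, rfl⟩

theorem hasCode_union {φ ψ : TwoCNF (Fin n)} {l l' : ℕ} :
    HasCode (φ ∪ ψ) l l' ↔ HasCode φ l l' ∨ HasCode ψ l l' := by
  simp only [HasCode, Set.mem_union, or_and_right, exists_or]

/-- The literal with number `l` holds at `K`. -/
def codeHolds (K : Set (Fin n)) (l : ℕ) : Prop :=
  ∃ k : Lit (Fin n), litCode k = l ∧ Lit.Holds K k

theorem codeHolds_litCode {K : Set (Fin n)} {k : Lit (Fin n)} :
    codeHolds K (litCode k) ↔ Lit.Holds K k := by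
  constructor
  · rintro ⟨k', h1, h2⟩
    rwa [litCode_injective h1] at h2
  · exact fun h => ⟨k, rfl, h⟩

theorem sat2_of_sat {φ : TwoCNF (Fin n)} {K : Set (Fin n)} (h : TwoCNF.Sat K φ) :
    sat2 (n + n) (HasCode φ) := by
  refine sat2_of_valuation (fun _ _ => HasCode.lt) (codeHolds K) ?_ ?_
  · intro l hl
    obtain ⟨⟨x, b⟩, rfl⟩ := exists_litCode_eq hl
    rw [flip2_litCode, codeHolds_litCode, codeHolds_litCode]
    cases b <;> simp [Lit.Holds]
  · rintro l l' ⟨c, hc, rfl, rfl⟩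
    rw [codeHolds_litCode, codeHolds_litCode]
    exact h c hc

/-- The greedy literals contain exactly one of each complementary pair, so the set read off from the
positive literals gives every literal its greedy value. -/
theorem sat_greedy2 {φ : TwoCNF (Fin n)} (h : sat2 (n + n) (HasCode φ)) :
    TwoCNF.Sat {x : Fin n | greedy2 (n + n) (HasCode φ) (x + x + 1)} φ := by
  have key : ∀ k : Lit (Fin n),
      Lit.Holds {x : Fin n | greedy2 (n + n) (HasCode φ) (x + x + 1)} k ↔
        greedy2 (n + n) (HasCode φ) (litCode k) := by
    rintro ⟨x, b⟩
    have h1 : litCode (x, true) = (x : ℕ) + x + 1 := litCode_eq x true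
    cases b
    · rw [show (x, false) = (x, !true) from rfl, ← flip2_litCode,
        greedy2_flip2 (fun _ _ => HasCode.lt) h (litCode_lt _), h1]
      simp [Lit.Holds]
    · rw [h1]
      simp [Lit.Holds]
  intro c hc
  rw [key, key]
  exact greedy2_clause (fun _ _ => HasCode.lt) h ⟨c, hc, rfl, rfl⟩

end Codes

/-! ### Agreement of the number predicates with the clauses of `phi` and of the sample -/

section Clauses

variable {n : ℕ} {G : SimpleGraph (Fin n)} {N : ℕ} (hN : n ≤ N) {u v : Fin n} {l l' : ℕ}
include hN

theorem phiTriN_iff : phiTriN N (natAdj G) u v l l' ↔ HasCode (phiTri G u v) l l' := by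
  constructor
  · rintro ⟨x, -, y, -, hx, hy, hxy, hn, h⟩
    obtain ⟨x, rfl⟩ : ∃ x' : Fin n, (x' : ℕ) = x := ⟨⟨x, triN_lt hx⟩, rfl⟩
    obtain ⟨y, rfl⟩ : ∃ y' : Fin n, (y' : ℕ) = y := ⟨⟨y, triN_lt hy⟩, rfl⟩
    rw [triN_iff] at hx hy
    rw [natAdj_val] at hn
    have hxy' : x ≠ y := fun h => hxy (congrArg _ h)
    rcases h with ⟨rfl, rfl⟩ | ⟨rfl, rfl⟩
    · exact ⟨_, ⟨x, hx, y, hy, hxy', hn, true, rfl⟩, by simp [litCode_eq], by simp [litCode_eq]⟩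
    · exact ⟨_, ⟨x, hx, y, hy, hxy', hn, false, rfl⟩, by simp [litCode_eq], by simp [litCode_eq]⟩
  · rintro ⟨_, ⟨x, hx, y, hy, hxy, hn, b, rfl⟩, rfl, rfl⟩
    refine ⟨x, by omega, y, by omega, triN_iff.2 hx, triN_iff.2 hy, fun h => hxy (Fin.ext h),
      by rwa [natAdj_val], ?_⟩
    cases b <;> simp [litCode_eq]

theorem phiConvN_iff (hG : G.Connected) (huv : G.Adj u v) :
    phiConvN N (natAdj G) u v l l' ↔ HasCode (phiConv G u v) l l' := by
  constructor
  · rintro ⟨x, -, ⟨hx, rfl, rfl⟩ | ⟨hx, rfl, rfl⟩⟩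
    · obtain ⟨x, rfl, hx'⟩ := exists_mem_mHull_of_hullN hN hG huv x hx
      exact ⟨_, .inl ⟨x, hx', rfl⟩, by simp [litCode_eq], by simp [litCode_eq]⟩
    · obtain ⟨x, rfl, hx'⟩ := exists_mem_mHull_of_hullN hN hG huv.symm x hx
      exact ⟨_, .inr ⟨x, hx', rfl⟩, by simp [litCode_eq], by simp [litCode_eq]⟩
  · rintro ⟨_, ⟨x, hx, rfl⟩ | ⟨x, hx, rfl⟩, rfl, rfl⟩
    · refine ⟨x, by omega, .inl ⟨(hullN_iff hN hG huv).2 hx, ?_⟩⟩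
      simp [litCode_eq]
    · refine ⟨x, by omega, .inr ⟨(hullN_iff hN hG huv.symm).2 hx, ?_⟩⟩
      simp [litCode_eq]

theorem phiTN_iff : phiTN N (natAdj G) n u v l l' ↔ HasCode (phiT G u v) l l' := by
  constructor
  · rintro ⟨x, -, y, -, hxn, hr, h⟩
    -- A number that is reached is either the start, bounded by `hxn`, or the end of an edge.
    have hy : y < n := by
      rcases (Relation.ReflTransGen.cases_tail
        ((reachN_iff fun i j h => (natAdj_lt h.1).2.trans_le hN).1 hr).2) with h | ⟨z, -, h⟩
      · omega
      · exact (natAdj_lt h.1).2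
    obtain ⟨x, rfl⟩ : ∃ x' : Fin n, (x' : ℕ) = x := ⟨⟨x, hxn⟩, rfl⟩
    obtain ⟨y, rfl⟩ : ∃ y' : Fin n, (y' : ℕ) = y := ⟨⟨y, hy⟩, rfl⟩
    rw [reachN_cutN_iff hN] at hr
    rcases h with ⟨rfl, rfl⟩ | ⟨rfl, rfl⟩
    · exact ⟨_, ⟨x, y, hr, true, rfl⟩, by simp [litCode_eq], by simp [litCode_eq]⟩
    · exact ⟨_, ⟨x, y, hr, false, rfl⟩, by simp [litCode_eq], by simp [litCode_eq]⟩
  · rintro ⟨_, ⟨x, y, hxy, b, rfl⟩, rfl, rfl⟩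
    refine ⟨x, by omega, y, by omega, x.2, (reachN_cutN_iff hN).2 hxy, ?_⟩
    cases b <;> simp [litCode_eq]

theorem phi3N_iff (hG : G.Connected) (huv : G.Adj u v) (b : Bool) :
    phi3N N (natAdj G) b.toNat (!b).toNat u v l l' ↔ HasCode (phi3 G u v b) l l' := by
  constructor
  · rintro ⟨x, -, y, -, z, -, hx, hz, hxy, hyz, hxz, hnxz, rfl, rfl⟩
    obtain ⟨x, y, rfl, rfl, hxy⟩ := hxy
    obtain ⟨z, rfl⟩ : ∃ z' : Fin n, (z' : ℕ) = z := ⟨⟨z, triN_lt hz⟩, rfl⟩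
    rw [natAdj_val] at hyz hnxz
    exact ⟨_, ⟨x, y, z, (sideAN_iff hN hG huv).1 hx, triN_iff.1 hz,
      ⟨hxy, hyz, fun h => hxz (congrArg _ h), hnxz⟩, rfl⟩, litCode_eq _ _, litCode_eq _ _⟩
  · rintro ⟨_, ⟨x, y, z, hx, hz, ⟨h1, h2, h3, h4⟩, rfl⟩, rfl, rfl⟩
    exact ⟨x, by omega, y, by omega, z, by omega, (sideAN_iff hN hG huv).2 hx, triN_iff.2 hz,
      natAdj_val.2 h1, natAdj_val.2 h2, fun h => h3 (Fin.ext h), by rwa [natAdj_val],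
      litCode_eq _ _, litCode_eq _ _⟩

theorem phi4N_iff (hG : G.Connected) (huv : G.Adj u v) (b : Bool) :
    phi4N N (natAdj G) b.toNat (!b).toNat u v l l' ↔ HasCode (phi4 G u v b) l l' := by
  constructor
  · rintro ⟨x, -, w, -, y, -, z, -, hx, hz, hxw, hwy, hyz, n1, n2, n3, m1, m2, m3, rfl, rfl⟩
    obtain ⟨x, w, rfl, rfl, hxw⟩ := hxw
    obtain ⟨y, z, rfl, rfl, hyz⟩ := hyz
    rw [natAdj_val] at hwy m1 m2 m3
    exact ⟨_, ⟨x, w, y, z, (sideAN_iff hN hG huv).1 hx, triN_iff.1 hz,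
      ⟨hxw, hwy, hyz, fun h => n1 (congrArg _ h), fun h => n2 (congrArg _ h),
        fun h => n3 (congrArg _ h), m1, m2, m3⟩, rfl⟩, litCode_eq _ _, litCode_eq _ _⟩
  · rintro ⟨_, ⟨x, w, y, z, hx, hz, ⟨h1, h2, h3, h4, h5, h6, h7, h8, h9⟩, rfl⟩, rfl, rfl⟩
    exact ⟨x, by omega, w, by omega, y, by omega, z, by omega, (sideAN_iff hN hG huv).2 hx,
      triN_iff.2 hz, natAdj_val.2 h1, natAdj_val.2 h2, natAdj_val.2 h3, fun h => h4 (Fin.ext h),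
      fun h => h5 (Fin.ext h), fun h => h6 (Fin.ext h), by rwa [natAdj_val], by rwa [natAdj_val],
      by rwa [natAdj_val], litCode_eq _ _, litCode_eq _ _⟩

theorem phiAN_iff (hG : G.Connected) (huv : G.Adj u v) (b : Bool) :
    phiAN N (natAdj G) b.toNat (!b).toNat u v l l' ↔ HasCode (phiA G u v b) l l' := by
  constructor
  · rintro ⟨x, -, y, -, z, -, hxy, hx, hz, hzx, hnxz, rfl, rfl⟩
    obtain ⟨x, y, rfl, rfl, hxy⟩ := hxy
    obtain ⟨z, rfl⟩ : ∃ z' : Fin n, (z' : ℕ) = z := ⟨⟨z, triN_lt hz⟩, rfl⟩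
    rw [natAdj_val] at hnxz
    exact ⟨_, ⟨x, y, z, hxy, (hullN_iff hN hG huv).1 hx, triN_iff.1 hz,
      fun h => hzx (congrArg _ h), hnxz, rfl⟩, litCode_eq _ _, litCode_eq _ _⟩
  · rintro ⟨_, ⟨x, y, z, h1, hx, hz, h3, h4, rfl⟩, rfl, rfl⟩
    exact ⟨x, by omega, y, by omega, z, by omega, natAdj_val.2 h1, (hullN_iff hN hG huv).2 hx,
      triN_iff.2 hz, fun h => h3 (Fin.ext h), by rwa [natAdj_val],
      litCode_eq _ _, litCode_eq _ _⟩

theorem phiN_iff (hG : G.Connected) (huv : G.Adj u v) :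
    phiN N (natAdj G) n u v l l' ↔ HasCode (phi G u v) l l' := by
  have h3 := phi3N_iff (l := l) (l' := l') hN hG huv true
  have h3' := phi3N_iff (l := l) (l' := l') hN hG huv.symm false
  have h4 := phi4N_iff (l := l) (l' := l') hN hG huv true
  have h4' := phi4N_iff (l := l) (l' := l') hN hG huv.symm false
  have h5 := phiAN_iff (l := l) (l' := l') hN hG huv true
  have h5' := phiAN_iff (l := l) (l' := l') hN hG huv.symm false
  simp only [Bool.toNat_true, Bool.not_true, Bool.toNat_false, Bool.not_false]
    at h3 h3' h4 h4' h5 h5'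
  simp only [phi, hasCode_union, phiN, phiTriN_iff hN, phiConvN_iff hN hG huv, phiTN_iff hN, h3,
    h3', h4, h4', h5, h5', or_assoc]

/-- The sample table as a relation. -/
def sampleRel (S : Finset (Fin n)) (y : S → Bool) (i j : ℕ) : Prop :=
  ∃ x : S, ((x : Fin n) : ℕ) = j ∧ (i = 0 ∨ (i = 1 ∧ y x = true))

omit hN in
theorem sampleRel_zero {S : Finset (Fin n)} {y : S → Bool} {j : ℕ} :
    sampleRel S y 0 j ↔ ∃ x : S, ((x : Fin n) : ℕ) = j := by
  simp [sampleRel]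

omit hN in
theorem sampleRel_one {S : Finset (Fin n)} {y : S → Bool} {x : S} :
    sampleRel S y 1 (x : Fin n) ↔ y x = true := by
  constructor
  · rintro ⟨x', h1, h2⟩
    have : x' = x := Subtype.ext (Fin.ext h1)
    simpa [this] using h2
  · exact fun h => ⟨x, rfl, .inr ⟨rfl, h⟩⟩

theorem clauseN_iff (hG : G.Connected) (huv : G.Adj u v) (S : Finset (Fin n)) (y : S → Bool) :
    clauseN N (natAdj G) (sampleRel S y) n u v l l' ↔ HasCode (phiSample G S y u v) l l' := by
  rw [clauseN, phiSample, hasCode_union, phiN_iff hN hG huv]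
  refine or_congr_right ?_
  constructor
  · rintro ⟨_, -, hx, h⟩
    obtain ⟨x, rfl⟩ := sampleRel_zero.1 hx
    rw [sampleRel_one] at h
    refine ⟨_, ⟨x, rfl⟩, ?_⟩
    simp only [litCode_eq]
    cases hy : y x <;> simp [hy] at h ⊢ <;> exact ⟨h.1.symm, h.2.symm⟩
  · rintro ⟨_, ⟨x, rfl⟩, rfl, rfl⟩
    refine ⟨(x : Fin n), by omega, sampleRel_zero.2 ⟨x, rfl⟩, ?_⟩
    rw [sampleRel_one]
    simp only [litCode_eq]
    cases hy : y x <;> simp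

theorem allOneN_iff (S : Finset (Fin n)) (y : S → Bool) :
    allOneN N (sampleRel S y) ↔ Consistent S y Set.univ := by
  constructor
  · intro h x
    refine ⟨fun _ => trivial, fun hy => ?_⟩
    exfalso
    refine h (x : Fin n) (by omega) ⟨sampleRel_zero.2 ⟨x, rfl⟩, ?_⟩
    rw [sampleRel_one, hy]
    simp
  · rintro h _ - ⟨hx, h'⟩
    obtain ⟨x, rfl⟩ := sampleRel_zero.1 hx
    rw [sampleRel_one, Bool.not_eq_true] at h'
    exact (h x).2 h' trivial

theorem allZeroN_iff (S : Finset (Fin n)) (y : S → Bool) :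
    allZeroN N (sampleRel S y) ↔ Consistent S y ∅ := by
  constructor
  · intro h x
    refine ⟨fun hy => ?_, fun _ h => h⟩
    exact absurd ⟨sampleRel_zero.2 ⟨x, rfl⟩, sampleRel_one.2 hy⟩ (h (x : Fin n) (by omega))
  · rintro h _ - ⟨hx, h'⟩
    obtain ⟨x, rfl⟩ := sampleRel_zero.1 hx
    exact (h x).1 (sampleRel_one.1 h')

end Clauses

/-! ### The answer of the algorithm -/

section Answer

variable {n : ℕ} {G : SimpleGraph (Fin n)} {S : Finset (Fin n)} {y : S → Bool}

theorem edgeSatN_iff (hG : G.Connected) {i j : ℕ} :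
    edgeSatN (n + n) (natAdj G) (sampleRel S y) n i j ↔
      ∃ u v : Fin n, (u : ℕ) = i ∧ (v : ℕ) = j ∧ G.Adj u v ∧
        sat2 (n + n) (HasCode (phiSample G S y u v)) := by
  have hcl : ∀ u v : Fin n, G.Adj u v →
      clauseN (n + n) (natAdj G) (sampleRel S y) n u v = HasCode (phiSample G S y u v) :=
    fun u v huv => funext₂ fun l l' => propext (clauseN_iff (by omega) hG huv S y)
  constructor
  · rintro ⟨⟨u, v, rfl, rfl, huv⟩, h⟩
    rw [hcl u v huv] at h
    exact ⟨u, v, rfl, rfl, huv, h⟩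
  · rintro ⟨u, v, rfl, rfl, huv, h⟩
    rw [← hcl u v huv] at h
    exact ⟨natAdj_val.2 huv, h⟩

theorem exists_firstSatN {N : ℕ} {R T : ℕ → ℕ → Prop} (h : someSatN N R T n) :
    ∃ u < N, ∃ v < N, firstSatN N R T n u v := by
  classical
  have h1 : ∃ u, u < N ∧ ∃ v, v < N ∧ edgeSatN N R T n u v := h
  obtain ⟨hu, h2⟩ := Nat.find_spec h1
  obtain ⟨hv, h3⟩ := Nat.find_spec h2
  refine ⟨_, hu, _, hv, h3, ?_⟩
  rintro u' hu' v' hv' ⟨h4 | ⟨rfl, h4⟩, h5⟩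
  · exact Nat.find_min h1 h4 ⟨hu', v', hv', h5⟩
  · exact Nat.find_min h2 h4 ⟨hv', h5⟩

/-- Membership is decided separately for each vertex; uniqueness guarantees that all these decisions
refer to the same formula and hence to one solution. -/
theorem firstSatN_unique {N : ℕ} {R T : ℕ → ℕ → Prop} {u v u' v' : ℕ}
    (h : firstSatN N R T n u v) (h' : firstSatN N R T n u' v') (hu : u < N) (hv : v < N)
    (hu' : u' < N) (hv' : v' < N) : u = u' ∧ v = v' := by
  have h1 : ¬ (u' < u ∨ u' = u ∧ v' < v) := fun h2 => h.2 u' hu' v' hv' ⟨h2, h'.1⟩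
  have h2 : ¬ (u < u' ∨ u = u' ∧ v < v') := fun h2 => h'.2 u hu v hv ⟨h2, h.1⟩
  omega

/-- The hypotheses on `r` are what the program establishes; what remains is the case distinction of
mh-check. -/
theorem mhCheckReturns_result (hG : G.Connected) (r : Option (Set (Fin n)))
    (hr : ¬ successN (n + n) (natAdj G) (sampleRel S y) n → r = none)
    (hr' : successN (n + n) (natAdj G) (sampleRel S y) n →
      r = some {x : Fin n | resultN (n + n) (natAdj G) (sampleRel S y) n x}) :
    MhCheckReturns G S y r := by
  by_cases hs : someSatN (n + n) (natAdj G) (sampleRel S y) n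
  · rw [hr' (.inl hs)]
    obtain ⟨i, hi, j, hj, hf⟩ := exists_firstSatN hs
    obtain ⟨u, v, rfl, rfl, huv, h⟩ := (edgeSatN_iff hG).1 hf.1
    refine .solution u v _ huv ?_
    convert sat_greedy2 h using 1
    ext x
    have hcl : clauseN (n + n) (natAdj G) (sampleRel S y) n u v =
        HasCode (phiSample G S y u v) :=
      funext₂ fun l l' => propext (clauseN_iff (by omega) hG huv S y)
    simp only [Set.mem_ofPred_eq, resultN]
    rw [← hcl]
    constructor
    · rintro (⟨i', hi', j', hj', hf', h⟩ | h)
      · obtain ⟨rfl, rfl⟩ := firstSatN_unique hf hf' hi hj hi' hj'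
        exact h
      · exact absurd hs h.1
    · exact fun h => .inl ⟨u, hi, v, hj, hf, h⟩
  · have hun : ∀ u v, G.Adj u v → ∀ K, ¬ TwoCNF.Sat K (phiSample G S y u v) := by
      intro u v huv K hK
      exact hs ⟨u, by omega, v, by omega, (edgeSatN_iff hG).2 ⟨u, v, rfl, rfl, huv,
        sat2_of_sat hK⟩⟩
    by_cases h1 : Consistent S y Set.univ
    · have h1' : allOneN (n + n) (sampleRel S y) := (allOneN_iff (by omega) S y).2 h1
      rw [hr' (.inr (.inl h1'))]
      have : {x : Fin n | resultN (n + n) (natAdj G) (sampleRel S y) n x} = Set.univ :=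
        Set.eq_univ_of_forall fun x => .inr ⟨hs, h1'⟩
      rw [this]
      exact .trivial _ hun (.inl rfl) h1
    · have h1' : ¬ allOneN (n + n) (sampleRel S y) := fun h => h1 ((allOneN_iff (by omega) S y).1 h)
      by_cases h0 : Consistent S y ∅
      · rw [hr' (.inr (.inr ((allZeroN_iff (by omega) S y).2 h0)))]
        have : {x : Fin n | resultN (n + n) (natAdj G) (sampleRel S y) n x} = ∅ := by
          refine Set.eq_empty_of_forall_notMem fun x hx => ?_
          rcases hx with ⟨i, hi, j, hj, hf, -⟩ | hx
          · exact hs ⟨i, hi, j, hj, hf.1⟩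
          · exact h1' hx.2
        rw [this]
        exact .trivial _ hun (.inr rfl) h0
      · rw [hr]
        · exact .failure hun h1 h0
        · rintro (h | h | h)
          · exact hs h
          · exact h1' h
          · exact h0 ((allZeroN_iff (by omega) S y).1 h)

theorem isMHalfspace_univ_or_empty {V : Type*} {G : SimpleGraph V} {H : Set V}
    (h : H = Set.univ ∨ H = ∅) : IsMHalfspace G H := by
  have h1 : IsMConvex G Set.univ := fun _ _ _ _ => Set.subset_univ _
  have h2 : IsMConvex G ∅ := fun _ h => h.elim
  rcases h with rfl | rfl
  · exact ⟨h1, by rwa [Set.compl_univ]⟩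
  · exact ⟨h2, by rwa [Set.compl_empty]⟩

theorem consistent_iff_sat {V : Type*} {S : Finset V} {y : S → Bool} {H : Set V} :
    Consistent S y H ↔
      TwoCNF.Sat H {c | ∃ x : S, c = (((x : V), y x), ((x : V), y x))} := by
  constructor
  · rintro h _ ⟨x, rfl⟩
    left
    have := h x
    cases hy : y x <;> simp_all [Lit.Holds]
  · intro h x
    have := h _ ⟨x, rfl⟩
    cases hy : y x <;> simp_all [Lit.Holds]

theorem exists_inCut {V : Type*} {G : SimpleGraph V} (hG : G.Connected) {H : Set V} {a b : V}
    (ha : a ∈ H) (hb : b ∉ H) : ∃ u v, InCut G H u v := by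
  obtain ⟨p⟩ := hG.preconnected a b
  induction p with
  | nil => exact absurd ha hb
  | @cons a w b h p ih =>
    by_cases hw : w ∈ H
    · exact ih hw hb
    · exact ⟨a, w, h, ha, hw⟩

/-- Only failure needs an argument: a consistent halfspace that is not trivial has a cut edge, and
it would satisfy the formula of that edge together with the sample clauses. -/
theorem MhCheckReturns.isCorrectAnswer {V : Type*} {G : SimpleGraph V} {S : Finset V}
    {y : S → Bool} (hG : G.Connected) {r : Option (Set V)} (h : MhCheckReturns G S y r) :
    IsCorrectAnswer G S y r := by
  cases h with
  | solution u v H huv hH =>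
    exact ⟨(isMHalfspace_of_sat hG huv fun c hc => hH c (.inl hc)).1,
      consistent_iff_sat.2 fun c hc => hH c (.inr hc)⟩
  | trivial H hun hH hc => exact ⟨isMHalfspace_univ_or_empty hH, hc⟩
  | failure hun hV he =>
    rintro ⟨H, hH, hc⟩
    by_cases h1 : H = Set.univ
    · exact hV (h1 ▸ hc)
    by_cases h0 : H = ∅
    · exact he (h0 ▸ hc)
    obtain ⟨a, ha⟩ := Set.nonempty_iff_ne_empty.2 h0
    obtain ⟨b, hb⟩ := (Set.ne_univ_iff_exists_notMem H).1 h1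
    obtain ⟨u, v, huv⟩ := exists_inCut hG ha hb
    refine hun u v huv.1 H fun c hc' => ?_
    rcases hc' with hc' | hc'
    · exact sat_of_isMHalfspace hG hH huv c hc'
    · exact consistent_iff_sat.1 hc c hc'

end Answer

/-! ### The programs -/

namespace Ctx

variable {α : Type} {Γ : Ctx α}

/-- A definable relation can be written to an array on which the environment does not depend. -/
theorem Def.exists_prog_write {P : α → ℕ → ℕ → Prop}
    (hP : Def Γ.extV.extV fun q => P q.1.1 q.1.2 q.2) {b : ℕ}
    (hb : ∀ a s i j x, Γ.Rep a s → Γ.Rep a (s.setArr b i j x)) (hbm : b < Γ.m) :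
    ∃ (c : Prog) (p : Polynomial ℕ), ∀ a s, Γ.Rep a s → ∃ t s', Exec c s t s' ∧
      t ≤ p.eval (Γ.size a) ∧ Γ.Rep a s' ∧
      ∀ i < Γ.size a, ∀ j < Γ.size a, s'.arr b i j ≠ 0 ↔ P a i j := by
  obtain ⟨c, p, h⟩ := hP
  -- The two extensions keep the row in `Γ.k + 1` and the column in `Γ.k + 3`, and `c` reports in
  -- `Γ.k + 4`. By `hbm` the test preserves the entries already written, and by `hb` the writes
  -- preserve the environment.
  let body : Prog := .seq c (.write b (.reg (Γ.k + 1)) (.reg (Γ.k + 3)) (.reg (Γ.k + 4)))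
  refine ⟨forProg (Γ.k + 1) (forProg (Γ.k + 3) body),
    (Polynomial.X + Polynomial.C 1) *
      ((Polynomial.X + Polynomial.C 1) * (p + Polynomial.C 12) + Polynomial.C 8),
    fun a s hs => ?_⟩
  have reg_rep : ∀ s x k, Γ.k ≤ x → Γ.Rep a s → Γ.Rep a (s.setReg x k) := fun s x k hx hs =>
    rep_of_agree hs ((Agree.refl _ _ _).setReg hx _)
  refine (exec_forProg (x := Γ.k + 1) (c := forProg (Γ.k + 3) body) (N := Γ.size a)
    (T := (Γ.size a + 1) * (p.eval (Γ.size a) + 12))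
    (fun i s' => Γ.Rep a s' ∧ ∀ i' < i, ∀ j < Γ.size a, s'.arr b i' j ≠ 0 ↔ P a i' j)
    ?_ ?_ ?_ (s := s) ⟨hs, by simp⟩).elim fun t ⟨s', he, ht, hI⟩ => ?_
  rotate_right
  · refine ⟨t, s', he, ?_, hI⟩
    simpa using ht
  · exact fun i s' k ⟨h1, h2⟩ => ⟨reg_rep _ _ _ (by omega) h1, h2⟩
  · exact fun i s' h1 => Γ.reg_zero _ _ h1.1
  intro i s1 hi ⟨hs1, hrows⟩ hi1
  refine (exec_forProg (x := Γ.k + 3) (c := body) (N := Γ.size a) (T := p.eval (Γ.size a) + 4)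
    (fun j s' => (Γ.Rep a s' ∧ s'.reg (Γ.k + 1) = i) ∧
      (∀ i' < i, ∀ j < Γ.size a, s'.arr b i' j ≠ 0 ↔ P a i' j) ∧
      ∀ j' < j, s'.arr b i j' ≠ 0 ↔ P a i j')
    ?_ ?_ ?_ (s := s1) ⟨⟨hs1, hi1⟩, hrows, by simp⟩).elim fun t ⟨s', he, ht, hI⟩ => ?_
  rotate_right
  · refine ⟨t, s', he, by simpa using ht, ⟨hI.1.1, ?_⟩, hI.1.2⟩
    intro i' hi' j hj
    rcases Nat.lt_succ_iff_lt_or_eq.1 hi' with h' | rfl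
    · exact hI.2.1 i' h' j hj
    · exact hI.2.2 j hj
  · exact fun j s' k ⟨⟨h1, h2⟩, h3⟩ => ⟨⟨reg_rep _ _ _ (by omega) h1, by
      rwa [Store.setReg_reg, if_neg (by omega)]⟩, h3⟩
  · exact fun i s' h1 => Γ.reg_zero _ _ h1.1.1
  intro j s2 hj ⟨hs2, hr2, hc2⟩ hj2
  obtain ⟨t, s3, he, ht, ha, hr⟩ := h ((a, i), j) s2 ⟨hs2, hj2⟩
  change t ≤ p.eval (Γ.size a) at ht
  change s3.reg (Γ.k + 4) ≠ 0 ↔ P a i j at hr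
  have hk1 : s3.reg (Γ.k + 1) = i := (ha.1 _ (by simp [extV])).trans hs2.2
  have hk3 : s3.reg (Γ.k + 3) = j := (ha.1 _ (by simp [extV])).trans hj2
  have harr : s3.arr b = s2.arr b := ha.2 b hbm
  have hs3 : Γ.Rep a s3 := rep_of_agree hs2.1 (ha.mono (by simp only [extV]; omega) le_rfl)
  refine ⟨_, _, .seq _ _ _ _ _ _ _ he (.write _ _ _ _ _), ?_,
    ⟨⟨hb _ _ _ _ _ hs3, hk1⟩, ?_, ?_⟩, hk3⟩
  · simp [Expr.cost]; omega
  · intro i' hi' j' hj'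
    rw [Store.setArr_arr]
    simp only [Expr.eval, hk1, hk3, true_and]
    rw [if_neg (by omega), harr]
    exact hr2 i' hi' j' hj'
  · intro j' hj'
    rw [Store.setArr_arr]
    simp only [Expr.eval, hk1, hk3, true_and]
    split_ifs with hjj
    · rw [hjj]; exact hr
    · rw [harr]
      exact hc2 j' (by omega)

end Ctx

/-- The data of the construction of `φ_uv`. -/
structure FormulaData where
  n : ℕ
  G : SimpleGraph (Fin n)
  u : Fin n
  v : Fin n

/-- The memory during the construction of `φ_uv`. -/
def formulaCtx : Ctx FormulaData where
  -- The registers hold `2n`, `u`, `v`, `n`. Three arrays are reserved though `Rep` speaks of two: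
  -- array `2` receives the output and must survive the tests between the writes.
  k := 4
  m := 3
  size d := d.n + d.n
  Rep d s := s.reg 0 = d.n + d.n ∧ s.reg 1 = d.u ∧ s.reg 2 = d.v ∧ s.reg 3 = d.n ∧
    (∀ i j, s.arr 0 i j ≠ 0 ↔ natAdj d.G i j) ∧ ∀ i j, s.arr 1 i j ≠ 0 ↔ False
  k_pos := by omega
  reg_zero _ _ h := h.1
  rep_congr d s s' h h1 h2 := by
    rwa [h1 0 (by omega), h1 1 (by omega), h1 2 (by omega), h1 3 (by omega), h2 0 (by omega),
      h2 1 (by omega)]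

theorem exists_prog_phi : ∃ (P : Prog) (p : Polynomial ℕ),
    ∀ (n : ℕ) (G : SimpleGraph (Fin n)), G.Connected → ∀ u v : Fin n, G.Adj u v →
      ∃ (t : ℕ) (s : Store), Exec P (formulaInput G u v) t s ∧
        t ≤ p.eval n ∧ formulaOutput n s = phi G u v := by
  have hu : formulaCtx.Tm fun d => (d.u : ℕ) := ⟨.reg 1, fun d s h => h.2.1⟩
  have hv : formulaCtx.Tm fun d => (d.v : ℕ) := ⟨.reg 2, fun d s h => h.2.2.1⟩
  -- There is no sample here; the zero array `1` serves as an empty table.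
  have I : formulaCtx.Inputs (fun d => natAdj d.G) (fun _ _ _ => False) (fun d => d.n) :=
    ⟨⟨0, fun d s h => h.2.2.2.2.1⟩, ⟨1, fun d s h => h.2.2.2.2.2⟩, ⟨.reg 3, fun d s h => h.2.2.2.1⟩⟩
  obtain ⟨c, p, h⟩ := Ctx.Def.exists_prog_write (Γ := formulaCtx) (b := 2)
    (P := fun d => phiN (d.n + d.n) (natAdj d.G) d.n d.u d.v)
    (Ctx.def_phiN I.v.v hu.v.v hv.v.v Ctx.Tm.var.v Ctx.Tm.var)
    (fun a s i j x hs => hs) (by decide)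
  -- Save `n` and double register `0`, in 2 + 4 steps. The time is then polynomial in `n + n`, hence
  -- the composition with `X + X`.
  refine ⟨.seq (.assign 3 (.reg 0)) (.seq (.assign 0 (.add (.reg 0) (.reg 0))) c),
    p.comp (Polynomial.X + Polynomial.X) + Polynomial.C 6, fun n G hG u v huv => ?_⟩
  obtain ⟨t, s, he, ht, -, hs⟩ := h ⟨n, G, u, v⟩
    (((formulaInput G u v).setReg 3 n).setReg 0 (n + n)) (by
      refine ⟨rfl, rfl, rfl, rfl, fun i j => ?_, fun i j => ?_⟩
      · simp [Store.setReg, formulaInput, adjTable, natAdj]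
      · simp [Store.setReg, formulaInput])
  have e1 : Exec (.assign 3 (.reg 0)) (formulaInput G u v) 2 ((formulaInput G u v).setReg 3 n) :=
    .assign 3 (.reg 0) _
  have e2 : Exec (.assign 0 (.add (.reg 0) (.reg 0))) ((formulaInput G u v).setReg 3 n) 4
      (((formulaInput G u v).setReg 3 n).setReg 0 (n + n)) :=
    .assign 0 (.add (.reg 0) (.reg 0)) _
  refine ⟨_, s, .seq _ _ _ _ _ _ _ e1 (.seq _ _ _ _ _ _ _ e2 he), ?_, ?_⟩
  · simp only [Polynomial.eval_add, Polynomial.eval_comp, Polynomial.eval_X, Polynomial.eval_C]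
    change t ≤ p.eval (n + n) at ht
    omega
  · ext c
    rw [← hasCode_litCode (φ := phi G u v), ← phiN_iff (N := n + n) (by omega) hG huv]
    exact hs _ (litCode_lt _) _ (litCode_lt _)

/-- The data of the consistency check. -/
structure CheckData where
  n : ℕ
  G : SimpleGraph (Fin n)
  S : Finset (Fin n)
  y : S → Bool

/-- The memory during the consistency check. -/
def checkCtx : Ctx CheckData where
  k := 2
  m := 3
  size d := d.n + d.n
  Rep d s := s.reg 0 = d.n + d.n ∧ s.reg 1 = d.n ∧
    (∀ i j, s.arr 0 i j ≠ 0 ↔ natAdj d.G i j) ∧ ∀ i j, s.arr 1 i j ≠ 0 ↔ sampleRel d.S d.y i j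
  k_pos := by omega
  reg_zero _ _ h := h.1
  rep_congr d s s' h h1 h2 := by
    rwa [h1 0 (by omega), h1 1 (by omega), h2 0 (by omega), h2 1 (by omega)]

theorem exists_prog_check : ∃ (P : Prog) (p : Polynomial ℕ),
    ∀ (n : ℕ) (G : SimpleGraph (Fin n)), G.Connected → ∀ (S : Finset (Fin n)) (y : S → Bool),
      ∃ (t : ℕ) (s : Store), Exec P (checkInput G S y) t s ∧ t ≤ p.eval n ∧
        MhCheckReturns G S y (checkOutput n s) := by
  have I : checkCtx.Inputs (fun d => natAdj d.G) (fun d => sampleRel d.S d.y) (fun d => d.n) :=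
    ⟨⟨0, fun d s h => h.2.2.1⟩, ⟨1, fun d s h => h.2.2.2⟩, ⟨.reg 1, fun d s h => h.2.1⟩⟩
  -- The predicate ignores the row, so every row receives the set; only row `0` is read as output.
  obtain ⟨c, p, h⟩ := Ctx.Def.exists_prog_write (Γ := checkCtx) (b := 2)
    (P := fun d _ => resultN (d.n + d.n) (natAdj d.G) (sampleRel d.S d.y) d.n)
    (Ctx.def_resultN I.v.v Ctx.Tm.var)
    (fun a s i j x hs => hs) (by decide)
  obtain ⟨c', p', h'⟩ := Ctx.def_successN I
  -- The test `c'` reports in register `2`, the result register of `checkCtx`. Its answer is moved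
  -- to register `0`, which holds the doubled size until then.
  refine ⟨.seq (.assign 1 (.reg 0)) (.seq (.assign 0 (.add (.reg 0) (.reg 0)))
    (.seq c (.seq c' (.assign 0 (.reg 2))))),
    (p + p').comp (Polynomial.X + Polynomial.X) + Polynomial.C 8, fun n G hG S y => ?_⟩
  obtain ⟨t, s, he, ht, hrep, hs⟩ := h ⟨n, G, S, y⟩
    (((checkInput G S y).setReg 1 n).setReg 0 (n + n)) (by
      refine ⟨rfl, rfl, fun i j => ?_, fun i j => ?_⟩
      · simp [Store.setReg, checkInput, adjTable, natAdj]
      · change sampleTable S y i j ≠ 0 ↔ sampleRel S y i j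
        unfold sampleTable
        split_ifs with h
        · exact iff_of_true one_ne_zero h
        · exact iff_of_false (fun h0 => h0 rfl) h)
  obtain ⟨t', s', he', ht', ha', hs'⟩ := h' ⟨n, G, S, y⟩ s hrep
  have e1 : Exec (.assign 1 (.reg 0)) (checkInput G S y) 2 ((checkInput G S y).setReg 1 n) :=
    .assign 1 (.reg 0) _
  have e2 : Exec (.assign 0 (.add (.reg 0) (.reg 0))) ((checkInput G S y).setReg 1 n) 4
      (((checkInput G S y).setReg 1 n).setReg 0 (n + n)) :=
    .assign 0 (.add (.reg 0) (.reg 0)) _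
  have e3 : Exec (.assign 0 (.reg 2)) s' 2 (s'.setReg 0 (s'.reg 2)) := .assign 0 (.reg 2) _
  refine ⟨_, _, .seq _ _ _ _ _ _ _ e1 (.seq _ _ _ _ _ _ _ e2 (.seq _ _ _ _ _ _ _ he
    (.seq _ _ _ _ _ _ _ he' e3))), ?_, ?_⟩
  · simp only [Polynomial.eval_add, Polynomial.eval_comp, Polynomial.eval_X, Polynomial.eval_C]
    change t ≤ p.eval (n + n) at ht
    change t' ≤ p'.eval (n + n) at ht'
    omega
  · have h2 : s'.reg 2 ≠ 0 ↔ successN (n + n) (natAdj G) (sampleRel S y) n := hs'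
    have harr : s'.arr 2 = s.arr 2 := ha'.2 2 (by decide)
    refine mhCheckReturns_result hG _ (fun hf => ?_) fun hf => ?_
    · rw [← h2, not_not] at hf
      exact if_pos hf
    · rw [← h2] at hf
      refine (if_neg hf).trans (congrArg some ?_)
      ext x
      change s'.arr 2 0 x ≠ 0 ↔ _
      rw [harr]
      -- Row `0` is within range because the vertex `x` witnesses that `n` is positive.
      exact hs 0 (by have := x.2; change 0 < n + n; omega) x (by have := x.2; change _ < n + n; omega)

end Mono

theorem mainTheorem1 :
    -- the solutions of `φ_uv` are exactly the m-halfspaces `H` with `uv ∈ δ(H)`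
    (∀ (n : ℕ) (G : SimpleGraph (Fin n)), G.Connected → ∀ u v : Fin n, G.Adj u v →
      ∀ H : Set (Fin n),
        Mono.TwoCNF.Sat H (Mono.phi G u v) ↔ Mono.IsMHalfspace G H ∧ Mono.InCut G H u v) ∧
    -- `φ_uv` is constructed in polynomial time
    (∃ (P : Mono.Prog) (p : Polynomial ℕ),
      ∀ (n : ℕ) (G : SimpleGraph (Fin n)), G.Connected → ∀ u v : Fin n, G.Adj u v →
        ∃ (t : ℕ) (s : Mono.Store), Mono.Exec P (Mono.formulaInput G u v) t s ∧
          t ≤ p.eval n ∧ Mono.formulaOutput n s = Mono.phi G u v) ∧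
    -- mh-check runs in polynomial time and answers correctly
    (∃ (P : Mono.Prog) (p : Polynomial ℕ),
      ∀ (n : ℕ) (G : SimpleGraph (Fin n)), G.Connected →
        ∀ (S : Finset (Fin n)) (y : S → Bool),
          ∃ (t : ℕ) (s : Mono.Store), Mono.Exec P (Mono.checkInput G S y) t s ∧
            t ≤ p.eval n ∧
            Mono.MhCheckReturns G S y (Mono.checkOutput n s) ∧
            Mono.IsCorrectAnswer G S y (Mono.checkOutput n s)) := by
  refine ⟨fun n G hG u v huv H => Mono.sat_phi_iff hG huv H, Mono.exists_prog_phi, ?_⟩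
  obtain ⟨P, p, h⟩ := Mono.exists_prog_check
  refine ⟨P, p, fun n G hG S y => ?_⟩
  obtain ⟨t, s, he, ht, hr⟩ := h n G hG S y
  exact ⟨t, s, he, ht, hr, hr.isCorrectAnswer hG⟩
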